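/- \textbf{Setting.} Let $\mathbb{L}/\mathbb{K}$ be a finite Galois extension with $\mathrm{G}=\mathrm{Gal}(\mathbb{L}/\mathbb{K})\cong(\mathbb{Z}/2\mathbb{Z})^m$; let $\theta_1,\dots,\theta_m\in\mathrm{G}$ correspond to the canonical basis. Let $\mathbb{L}=\mathbb{K}(\alpha_1,\dots,\alpha_m)$ where * (Kummer case, $\operatorname{char}\mathbb{K}\neq2$) $\alpha_j^2=a_j\in\mathbb{K}$ and $\theta_i(\alpha_j)=(-1)^{\delta_{ij}}\alpha_j$; * (Artin–Schreier case, $\operatorname{char}\mathbb{K}=2$) $\alpha_j^2+\alpha_j=a_j\in\mathbb{K}$ and $\theta_i(\alpha_j)=\alpha_j+\delta_{ij}$. Let $\mathcal{B}_0=(1)$ and $\mathcal{B}_{i+1}=\mathcal{B}_i\cup\mathcal{B}_i\alpha_{i+1}$, so that $\mathcal{B}_m$ is a $\mathbb{K}$-basis of $\mathbb{L}$. An element $f=\sum_{g}f_g\,g$ of the skew group algebra $\mathbb{L}[\mathrm{G}]$ acts on $\mathbb{L}$ by $x\mapsto\sum_g f_g\,g(x)$, and $\mathrm{RM}_{\mathbb{L}/\mathbb{K}}(r,m)$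 is the set of those $f$ with $f_g=0$ whenever the Hamming weight of $g\in(\mathbb{Z}/2\mathbb{Z})^m$ exceeds $r$ (it is $0$ for $r<0$). The code is viewed either as the set of matrices in $\mathbb{K}^{2^m\times2^m}$ of its elements in the basis $\mathcal{B}_m$, or as the $\mathbb{L}$-subspace of $\mathbb{L}^{2^m}$ of the vectors $(f(\beta))_{\beta\in\mathcal{B}_m}$; a matrix represents the vector whose $j$-th entry has the $j$-th column as its coordinates in $\mathcal{B}_m$. For a subextension $\mathbb{K}(\alpha_m)$, the code $\mathrm{RM}_{\mathbb{L}/\mathbb{K}(\alpha_m)}(r,m-1)$ is formed in the same way with $\theta_1,\dots,\theta_{m-1}$, $\alpha_1,\dots,\alpha_{m-1}$ and $\mathcal{B}_{m-1}$. \textbf{Folding.} For $m\ge1$, the folding of $\mathbf{Y}\in\mathbb{K}^{2^m\times2^m}$ is the matrix over $\mathbb{K}(\alpha_m)$ of size $2^{m-1}\times2^{m-1}$ $$\mathrm{Fold}(\mathbf{Y})=\begin{pmatrix}\alpha_m^{-1}\mathbf{I}&\mathbf{I}\end{pmatrix}\mathbf{Y}\begin{pmatrix}\mathbf{I}\\-\alpha_m^{-1}\mathbf{I}\end{pmatrix}\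 (\text{Kummer}),\qquad \mathrm{Fold}(\mathbf{Y})=\begin{pmatrix}\mathbf{I}&\alpha_m\mathbf{I}\end{pmatrix}\mathbf{Y}\begin{pmatrix}\mathbf{I}\\\alpha_m^{-1}\mathbf{I}\end{pmatrix}\ (\text{Artin–Schreier}).$$ Iterated foldings are taken successively along $\alpha_m,\alpha_{m-1},\dots$, the $i$-th one being of size $2^{m-i}\times2^{m-i}$ over $\mathbb{K}(\alpha_m,\dots,\alpha_{m-i+1})$. \textbf{Erasure decoding} of $\mathbf{X}\in\mathbb{K}^{2^m\times 2^m}$ in $\mathrm{RM}_{\mathbb{L}/\mathbb{K}}(r,m)$, given a subspace $V\subseteq\mathbb{K}^{2^m}$. Take any parity-check matrix $\mathbf{H}\in\mathbb{L}^{(2^m-k)\times2^m}$ of the ($k$-dimensional) vector code and any $\mathbf{R}\in\mathbb{K}^{\dim V\times2^m}$ whose rows span $V$. If the linear system $(\mathbf{H}\mathbf{R}^\top)\mathbf{z}^\top=\mathbf{H}\mathbf{x}^\top$ in $\mathbf{z}\in\mathbb{L}^{\dim V}$, where $\mathbf{x}$ is the vector represented by $\mathbf{X}$, has a solution, take any one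 and return $\mathbf{X}-\mathbf{E}$, where $\mathbf{E}$ is the matrix representing $\mathbf{z}\mathbf{R}$; otherwise declare a decoding failure. \textbf{Algorithm DecodeRM}$(\mathbf{Y};r,m,\mathbb{L},\mathbb{K})$. 1. If $r=-1$, return $\mathbf{0}$. (If $r\neq-1$ and $m=0$, declare a decoding failure.) 2. Compute $\mathbf{Y}'=\mathrm{Fold}(\mathbf{Y})$ and call DecodeRM on $(\mathbf{Y}';r-1,m-1,\mathbb{L},\mathbb{K}(\alpha_m))$; if it fails, declare a failure, otherwise let $\mathbf{M}$ be its result. 3. Write $\mathbf{M}=\frac{2}{\alpha_m}\mathbf{B}_0+2\mathbf{B}_1$ (Kummer) or $\mathbf{M}=\frac1{\alpha_m}\mathbf{B}_0+\mathbf{B}_1$ (Artin–Schreier), with $\mathbf{B}_0,\mathbf{B}_1$ over $\mathbb{K}$. 4. Set $\widetilde{\mathbf{Y}}=\mathbf{Y}-\begin{pmatrix}\mathbf{B}_0&-a_m\mathbf{B}_1\\\mathbf{B}_1&-\mathbf{B}_0\end{pmatrix}$ (Kummer) or $\mathbf{Y}-\begin{pmatrix}\mathbf{B}_0&a_m\mathbf{B}_1+\mathbf{B}_0\\\mathbf{B}_1&\mathbf{B}_0\end{pmatrix}$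 (Artin–Schreier), and let $\widetilde{\mathbf{Y}}_0$ be the lower half of $\widetilde{\mathbf{Y}}\begin{pmatrix}\mathbf{I}\\-\alpha_m^{-1}\mathbf{I}\end{pmatrix}$. 5. Apply erasure decoding in $\mathrm{RM}_{\mathbb{L}/\mathbb{K}(\alpha_m)}(r,m-1)$ to $\widetilde{\mathbf{Y}}_0$, with $V$ the row space over $\mathbb{K}(\alpha_m)$ of $\mathbf{Y}'-\mathbf{M}$; if it fails, declare a failure. Write its result as $\mathbf{A}_1-\alpha_m^{-1}\mathbf{A}_0$ (Kummer) or $\mathbf{A}_1+\alpha_m^{-1}(\mathbf{A}_0+\mathbf{A}_1)$ (Artin–Schreier), with $\mathbf{A}_0,\mathbf{A}_1$ over $\mathbb{K}$. 6. Return $\begin{pmatrix}\mathbf{A}_0+\mathbf{B}_0&a_m(\mathbf{A}_1-\mathbf{B}_1)\\\mathbf{A}_1+\mathbf{B}_1&\mathbf{A}_0-\mathbf{B}_0\end{pmatrix}$ (Kummer) or $\begin{pmatrix}\mathbf{A}_0+\mathbf{B}_0&a_m(\mathbf{A}_1+\mathbf{B}_1)+\mathbf{B}_0\\\mathbf{A}_1+\mathbf{B}_1&\mathbf{A}_0+\mathbf{A}_1+\mathbf{B}_0\end{pmatrix}$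 (Artin–Schreier). \textbf{Theorem (correctness of DecodeRM).} Let $-1\le r\le m$ be integers and let $\mathbf{Y}=\mathbf{C}+\mathbf{E}\in\mathbb{K}^{2^m\times2^m}$ with $\mathbf{C}\in\mathrm{RM}_{\mathbb{L}/\mathbb{K}}(r,m)$ and $\mathrm{Rk}(\mathbf{E})=t\le2^{m-r-1}-1$. Assume that for every $i\le\min(r+1,m)$ the $i$-th iterated folding of $\mathbf{E}$ has rank $t$. Then DecodeRM on input $(\mathbf{Y};r,m,\mathbb{L},\mathbb{K})$ returns $\mathbf{C}$: the algorithm has a run on this input, and whatever parity-check matrices, matrices $\mathbf{R}$ and solutions are chosen, the result is $\mathbf{C}$ (never a failure). -/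

import Mathlib

universe u

noncomputable section

namespace RankRM

open Matrix

/-! ### Matrices of size `2 ^ m` and the iterated basis -/

/-- Index set of the `2 ^ m × 2 ^ m` matrices: a set with `2 ^ m` elements, split recursively in
two halves, so that a matrix of size `2 ^ (m + 1)` is a `2 × 2` block matrix. -/
def Idx : ℕ → Type
  | 0 => Unit
  | m + 1 => Idx m ⊕ Idx m

instance Idx.instFintype : (m : ℕ) → Fintype (Idx m)
  | 0 => inferInstanceAs (Fintype Unit)
  | m + 1 =>
    haveI := Idx.instFintype m
    inferInstanceAs (Fintype (Idx m ⊕ Idx m))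

instance Idx.instDecidableEq : (m : ℕ) → DecidableEq (Idx m)
  | 0 => inferInstanceAs (DecidableEq Unit)
  | m + 1 =>
    haveI := Idx.instDecidableEq m
    inferInstanceAs (DecidableEq (Idx m ⊕ Idx m))

/-- Square matrices of size `2 ^ m`. -/
abbrev SqMat (m : ℕ) (K : Type u) : Type u := Matrix (Idx m) (Idx m) K

/-- Matrices of size `2 ^ (m + 1)` written in blocks of size `2 ^ m`; by definition of `Idx` this
is the same type as `SqMat (m + 1) K`. -/
abbrev BlockMat (m : ℕ) (K : Type u) : Type u := Matrix (Idx m ⊕ Idx m) (Idx m ⊕ Idx m) K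

/-- The family `𝓑_m`: `𝓑_0 = (1)` and `𝓑_{m+1} = 𝓑_m ∪ 𝓑_m α_{m+1}`; so `𝓑_m` is the family of
all products of distinct elements among `α_1, …, α_m`. -/
def basisFam {L : Type u} [Field L] : (m : ℕ) → (Fin m → L) → Idx m → L
  | 0, _ => fun _ => 1
  | m + 1, α =>
    Sum.elim (basisFam m (Fin.init α)) (fun s => basisFam m (Fin.init α) s * α (Fin.last m))

/-! ### The skew group algebra and the codes -/

section Codes

variable (K : Type u) {L : Type u} [Field K] [Field L] [Algebra K L]

/-- The `K`-endomorphism `x ↦ ∑ f_g g(x)` of `L` attached to `f = ∑ f_g g` in the skew group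
algebra `L[G]`, `G = Gal(L/K)`. -/
def toEnd : SkewMonoidAlgebra L (L ≃ₐ[K] L) →ₗ[L] (L →ₗ[K] L) :=
  (Finsupp.linearCombination L (fun g : L ≃ₐ[K] L => g.toLinearMap)) ∘ₗ
    (SkewMonoidAlgebra.coeffLinearEquiv (S := L)).toLinearMap

/-- The vector `(φ(β_j))_j` of values of an endomorphism `φ` at a family `β`. -/
def evalAt {ι : Type} (β : ι → L) : (L →ₗ[K] L) →ₗ[L] (ι → L) where
  toFun φ := fun j => φ (β j)
  map_add' _ _ := rfl
  map_smul' _ _ := rfl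

/-- The binary rank metric Reed–Muller code of order `r` and type `m`, in the skew group algebra:
all `∑ f_g g` supported on the `g` of Hamming weight at most `r`. Here `c g` is `g` seen as a
vector of `(ℤ/2ℤ)^m`. It is zero for `r < 0`. -/
def RM {m : ℕ} (c : (L ≃ₐ[K] L) → (Fin m → ZMod 2)) (r : ℤ) :
    Submodule L (SkewMonoidAlgebra L (L ≃ₐ[K] L)) where
  carrier := {f | ∀ g, f.coeff g ≠ 0 → (hammingNorm (c g) : ℤ) ≤ r}
  zero_mem' := by
    intro g hg
    simp at hg
  add_mem' := by
    intro f₁ f₂ h₁ h₂ g hg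
    by_cases h : f₁.coeff g = 0
    · refine h₂ g fun h' => hg ?_
      simp [h, h']
    · exact h₁ g h
  smul_mem' := by
    intro a f hf g hg
    refine hf g fun h => hg ?_
    simp [h]

/-- The code as a space of vectors: evaluations of the elements of `RM` at `𝓑_m`. -/
def RMvec {m : ℕ} (c : (L ≃ₐ[K] L) → (Fin m → ZMod 2)) (α : Fin m → L) (r : ℤ) :
    Submodule L (Idx m → L) :=
  (RM K c r).map (evalAt K (basisFam m α) ∘ₗ toEnd K)

/-- The vector of `L^(2^m)` represented by a matrix over `K`: the `j`-th column of the matrix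
holds the coordinates of the `j`-th entry with respect to `𝓑_m`. -/
def toVec {m : ℕ} (α : Fin m → L) (X : SqMat m K) : Idx m → L :=
  fun j => ∑ i, X i j • basisFam m α i

/-- The code as a set of matrices: the matrices, in `𝓑_m`, of the endomorphisms attached to the
elements of `RM`. -/
def RMmat {m : ℕ} (c : (L ≃ₐ[K] L) → (Fin m → ZMod 2)) (α : Fin m → L) (r : ℤ) :
    Set (SqMat m K) :=
  {X | ∃ f ∈ RM K c r, ∀ j,
    toEnd K f (basisFam m α j) = ∑ i, X i j • basisFam m α i}

/-- The elements `α_1, …, α_m` generate `L` over `K`, are square roots (Kummer case,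
characteristic `≠ 2`) or Artin–Schreier roots (characteristic `2`) of the `a_i ∈ K`, and the
generators `θ_1, …, θ_m` of `Gal(L/K) ≅ (ℤ/2ℤ)^m` (the images of the canonical basis) act on them
by `θ_i(α_j) = (-1)^δ_ij α_j`, respectively `θ_i(α_j) = α_j + δ_ij`. -/
structure IsGeneratingSystem {m : ℕ} (e : (L ≃ₐ[K] L) ≃* Multiplicative (Fin m → ZMod 2))
    (a : Fin m → K) (α : Fin m → L) : Prop where
  adjoin_eq_top : IntermediateField.adjoin K (Set.range α) = ⊤
  kummer : ringChar K ≠ 2 → ∀ j, α j ^ 2 = algebraMap K L (a j) ∧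
    ∀ i, e.symm (Multiplicative.ofAdd (Pi.single i 1)) (α j) = (if i = j then -1 else 1) * α j
  artinSchreier : ringChar K = 2 → ∀ j, α j ^ 2 + α j = algebraMap K L (a j) ∧
    ∀ i, e.symm (Multiplicative.ofAdd (Pi.single i 1)) (α j) = α j + (if i = j then 1 else 0)

end Codes

/-! ### Folding -/

section Folding

/-- The field `K(x) ⊆ L`. -/
abbrev Ext (K : Type u) {L : Type u} [Field K] [Field L] [Algebra K L] (x : L) : Type u :=
  ↥(IntermediateField.adjoin K ({x} : Set L))

variable (K : Type u) {L : Type u} [Field K] [Field L] [Algebra K L]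

/-- `x` as an element of `K(x)`. -/
def Ext.gen (x : L) : Ext K x := IntermediateField.AdjoinSimple.gen K x

/-- Extension of the entries from `K` to `K(x)`. -/
def liftMat {m n : Type} (x : L) (Y : Matrix m n K) : Matrix m n (Ext K x) :=
  Y.map (algebraMap K (Ext K x))

/-- The block column `(I ; -x⁻¹ I)` (so `(I ; x⁻¹ I)` in characteristic two). -/
def rightFactor (m : ℕ) (x : L) : Matrix (Idx m ⊕ Idx m) (Idx m) (Ext K x) :=
  Matrix.fromRows (1 : SqMat m (Ext K x)) (-((Ext.gen K x)⁻¹ • (1 : SqMat m (Ext K x))))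

/-- The block row `(x⁻¹ I, I)`, and `(I, x I)` in characteristic two. -/
def leftFactor (m : ℕ) (x : L) : Matrix (Idx m) (Idx m ⊕ Idx m) (Ext K x) :=
  if ringChar K = 2 then
    Matrix.fromCols (1 : SqMat m (Ext K x)) (Ext.gen K x • (1 : SqMat m (Ext K x)))
  else
    Matrix.fromCols ((Ext.gen K x)⁻¹ • (1 : SqMat m (Ext K x))) (1 : SqMat m (Ext K x))

/-- Folding of a matrix of size `2 ^ (m + 1)` over `K` into one of size `2 ^ m` over `K(x)`. -/
def fold {m : ℕ} (x : L) (Y : BlockMat m K) : SqMat m (Ext K x) :=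
  leftFactor K m x * liftMat K x Y * rightFactor K m x

end Folding

/-- Rank of the `i`-th iterated folding of a matrix `E` of size `2 ^ m` over `K`: fold along
`α_m`, then `α_{m-1}`, …, then `α_{m-i+1}`. Meaningful for `i ≤ m` (and set to `0` for `i > m`). -/
def foldRank {L : Type u} [Field L] : (m : ℕ) → (K : Type u) → [Field K] → [Algebra K L] →
    (Fin m → L) → SqMat m K → ℕ → ℕ
  | _, _, _, _, _, E, 0 => E.rank
  | 0, _, _, _, _, _, _ + 1 => 0
  | m + 1, K, _, _, α, E, i + 1 =>
    foldRank m (Ext K (α (Fin.last m))) (Fin.init α) (fold K (α (Fin.last m)) E) i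

/-! ### The algorithms

Both algorithms leave choices open (a parity-check matrix, a generating matrix of a row space, a
solution of a linear system). They are therefore described by the relation
"on this input, some run ends with the result `out`", where `some C` means that
`C` is returned and `none` means "decoding failure". -/

section Algorithms

variable (K : Type u) {L : Type u} [Field K] [Field L] [Algebra K L]

/-- `H` is a parity-check matrix of the code `V ⊆ L^(2^m)`; it has `2 ^ m - dim V` rows. -/
def IsParityCheck {m : ℕ} (V : Submodule L (Idx m → L))
    (H : Matrix (Fin (2 ^ m - Module.finrank L V)) (Idx m) L) : Prop :=
  ∀ v, v ∈ V ↔ H *ᵥ v = 0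

/-- The row space of a matrix. -/
def rowSpace {m n : Type} (X : Matrix m n K) : Submodule K (n → K) :=
  Submodule.span K (Set.range X.row)

/-- Erasure decoding of `X` in the code `RM(r, m)` of `L/K`, given a space `V` meant to contain
the row space of the error. Choose a parity-check matrix `H` and a matrix `R` with `dim V` rows
that span `V`. If the system `(H Rᵀ) zᵀ = H xᵀ` (`x` the vector represented by `X`) has a solution,
choose one, form the matrix `E` that represents `z R` and return `X - E`; otherwise fail. -/
def ErasureDecRM {m : ℕ} (c : (L ≃ₐ[K] L) → (Fin m → ZMod 2)) (α : Fin m → L) (r : ℤ)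
    (X : SqMat m K) (V : Submodule K (Idx m → K)) (out : Option (SqMat m K)) : Prop :=
  ∃ H : Matrix (Fin (2 ^ m - Module.finrank L (RMvec K c α r))) (Idx m) L,
    IsParityCheck (RMvec K c α r) H ∧
  ∃ R : Matrix (Fin (Module.finrank K V)) (Idx m) K, rowSpace K R = V ∧
    let RL : Matrix (Fin (Module.finrank K V)) (Idx m) L := R.map (algebraMap K L)
    (∃ z : Fin (Module.finrank K V) → L, (H * RLᵀ) *ᵥ z = H *ᵥ toVec K α X ∧
      ∃ E : SqMat m K, toVec K α E = z ᵥ* RL ∧ out = some (X - E)) ∨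
    ((¬ ∃ z : Fin (Module.finrank K V) → L, (H * RLᵀ) *ᵥ z = H *ᵥ toVec K α X) ∧ out = none)

/-- The matrix of size `2 ^ (m + 1)` assembled from `A₀, A₁, B₀, B₁` by the recursive structure
of the codes (`a = x²`, or `a = x² + x` in characteristic two, `x` the last `α`). -/
def assemble {m : ℕ} (a : K) (A₀ A₁ B₀ B₁ : SqMat m K) : BlockMat m K :=
  if ringChar K = 2 then
    Matrix.fromBlocks (A₀ + B₀) (a • (A₁ + B₁) + B₀) (A₁ + B₁) (A₀ + A₁ + B₀)
  else
    Matrix.fromBlocks (A₀ + B₀) (a • (A₁ - B₁)) (A₁ + B₁) (A₀ - B₀)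

/-- `(2/x) B₀ + 2 B₁`, and `(1/x) B₀ + B₁` in characteristic two. -/
def combineB {m : ℕ} (x : L) (B₀ B₁ : SqMat m K) : SqMat m (Ext K x) :=
  if ringChar K = 2 then
    (Ext.gen K x)⁻¹ • liftMat K x B₀ + liftMat K x B₁
  else
    (2 * (Ext.gen K x)⁻¹) • liftMat K x B₀ + (2 : Ext K x) • liftMat K x B₁

/-- `A₁ - (1/x) A₀`, and `A₁ + (1/x) (A₀ + A₁)` in characteristic two. -/
def combineA {m : ℕ} (x : L) (A₀ A₁ : SqMat m K) : SqMat m (Ext K x) :=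
  if ringChar K = 2 then
    liftMat K x A₁ + (Ext.gen K x)⁻¹ • liftMat K x (A₀ + A₁)
  else
    liftMat K x A₁ - (Ext.gen K x)⁻¹ • liftMat K x A₀

/-- Lower half of a matrix with `2 ^ (m + 1)` rows. -/
def lowerHalf {m : ℕ} {n : Type} {F : Type u} (X : Matrix (Idx m ⊕ Idx m) n F) :
    Matrix (Idx m) n F :=
  Matrix.of fun i j => X (Sum.inr i) j

/-- For `g ∈ Gal(L/K(x))`, the first `m` of the `m + 1` coordinates of `g` seen in `Gal(L/K)`. -/
def initCoord {m : ℕ} (x : L) (c : (L ≃ₐ[K] L) → (Fin (m + 1) → ZMod 2)) :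
    (L ≃ₐ[Ext K x] L) → (Fin m → ZMod 2) :=
  fun g => Fin.init (c (g.restrictScalars K))

end Algorithms

/-- `DecodeRM m K c a α r Y out`: some run of the recursive decoder for the code `RM(r, m)` of
`L/K` on the input `Y` ends with the result `out`. -/
def DecodeRM {L : Type u} [Field L] : (m : ℕ) → (K : Type u) → [Field K] → [Algebra K L] →
    ((L ≃ₐ[K] L) → (Fin m → ZMod 2)) → (Fin m → K) → (Fin m → L) → ℤ →
    SqMat m K → Option (SqMat m K) → Prop
  | 0, _, _, _, _, _, _, r, _, out =>
    -- a matrix of size one cannot be folded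
    (r = -1 ∧ out = some 0) ∨ (r ≠ -1 ∧ out = none)
  | m + 1, K, _, _, c, a, α, r, Y, out =>
    -- initialization: the zero code
    (r = -1 ∧ out = some 0) ∨
    (r ≠ -1 ∧
      let x : L := α (Fin.last m)
      let c' : (L ≃ₐ[Ext K x] L) → (Fin m → ZMod 2) := initCoord K x c
      let a' : Fin m → Ext K x := fun i => algebraMap K (Ext K x) (a i.castSucc)
      let α' : Fin m → L := Fin.init α
      -- folding
      let Y' : SqMat m (Ext K x) := fold K x Y
      -- recursive call over `K(x)`
      ((DecodeRM m (Ext K x) c' a' α' (r - 1) Y' none ∧ out = none) ∨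
        ∃ M : SqMat m (Ext K x), DecodeRM m (Ext K x) c' a' α' (r - 1) Y' (some M) ∧
        -- extraction of `B₀, B₁`
        ∃ B₀ B₁ : SqMat m K, M = combineB K x B₀ B₁ ∧
          let Yb : BlockMat m K := Y
          let Yt : BlockMat m K := Yb - assemble K (a (Fin.last m)) 0 0 B₀ B₁
          let Y₀ : SqMat m (Ext K x) := lowerHalf (liftMat K x Yt * rightFactor K m x)
          -- row space of the folded error
          let V : Submodule (Ext K x) (Idx m → Ext K x) := rowSpace (Ext K x) (Y' - M)
          -- erasure decoding and extraction of `A₀, A₁`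
          ((ErasureDecRM (Ext K x) c' α' r Y₀ V none ∧ out = none) ∨
            ∃ W : SqMat m (Ext K x), ErasureDecRM (Ext K x) c' α' r Y₀ V (some W) ∧
            ∃ A₀ A₁ : SqMat m K, W = combineA K x A₀ A₁ ∧
              out = some (assemble K (a (Fin.last m)) A₀ A₁ B₀ B₁))))

end RankRM

end

/-! Write `x = α_m` and let `θ` be the automorphism conjugating `x` and fixing the other generators.
Splitting the automorphisms by their last coordinate gives `f = f₀ + f₁ θ`, where `f₀` and `f₁` lie
over `K(x)`, in the codes of type `m - 1` and orders `r` and `r - 1`. Expanding their matrices in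
`1, x` produces `A₀, A₁` and `B₀, B₁` (`exists_assemble`). Folding annihilates the `A` part and
turns the `B` part into a codeword of order `r - 1` (`fold_assemble`). Hence `Fold(Y)` is a codeword
plus `Fold(E)`. The rank is still `t` by assumption, and the bound on `t` is unchanged because `m -
r` is, so induction recovers `B₀, B₁`.

Once the `B` part is subtracted, the lower half seen by the erasure decoder is a codeword of order
`r` plus a block of rows of `E (I ; -x⁻¹ I)`. `Fold(E)` is a left multiple of that product, and both
have rank `t`, so their row spaces agree (`rowSpace_fold_eq`). The space `V` therefore contains the
rows of the remaining error. Erasure decoding is then unambiguous because `t` is smaller than the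
minimum distance `2 ^ (m - 1 - r)`.

The distance bound (`two_pow_le_rank`) uses the same recursion. If the `B` part is nonzero, folding
does not increase the rank. If it vanishes, the matrix over `K` has at least twice the rank of the
matrix over `K(x)` built from `A₀, A₁`.

The induction changes the base field to `K(x)`. It is carried by `IsMultiquadratic`, which passes to
`K(x)` (`IsMultiquadratic.ext`) and asks only for a surjective coordinate map `c` instead of a group
isomorphism. -/

noncomputable section

namespace RankRM

open Matrix

/-! ### Multiquadratic extensions: passage to `K(α_m)` and the basis `𝓑_m` -/

section Multiquadratic

variable (K : Type u) {L : Type u} [Field K] [Field L] [Algebra K L]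

/-- The other root of the quadratic polynomial of a Kummer, respectively Artin–Schreier,
generator `y`. -/
def conjRoot (y : L) : L := if ringChar K = 2 then y + 1 else -y

/-- The extension `L/K` is generated by square roots or Artin–Schreier roots `α_j` of the `a_j`,
and `c` describes the action of its automorphisms on the `α_j`. -/
structure IsMultiquadratic {m : ℕ} (c : (L ≃ₐ[K] L) → (Fin m → ZMod 2))
    (a : Fin m → K) (α : Fin m → L) : Prop where
  adjoin_eq_top : IntermediateField.adjoin K (Set.range α) = ⊤
  root : ∀ j, if ringChar K = 2 then α j ^ 2 + α j = algebraMap K L (a j)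
    else α j ^ 2 = algebraMap K L (a j)
  act : ∀ g j, g (α j) = if c g j = 0 then α j else conjRoot K (α j)
  surj : Function.Surjective c
  conj_ne : ∀ j, conjRoot K (α j) ≠ α j

variable {K}

theorem conjRoot_conjRoot (y : L) : conjRoot K (conjRoot K y) = y := by
  unfold conjRoot
  split_ifs with h
  · have : CharP K 2 := ringChar.of_eq h
    have : CharP L 2 := charP_of_injective_algebraMap (algebraMap K L).injective 2
    rw [add_assoc, CharTwo.add_self_eq_zero, add_zero]
  · exact neg_neg y

theorem map_conjRoot (g : L ≃ₐ[K] L) (y : L) : g (conjRoot K y) = conjRoot K (g y) := by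
  unfold conjRoot
  split_ifs <;> simp

theorem algEquiv_ext_of_adjoin {ι : Type*} {α : ι → L}
    (h : IntermediateField.adjoin K (Set.range α) = ⊤) {g g' : L ≃ₐ[K] L}
    (hg : ∀ j, g (α j) = g' (α j)) : g = g' := by
  have key : ∀ y ∈ IntermediateField.adjoin K (Set.range α), g y = g' y := by
    intro y hy
    induction hy using IntermediateField.adjoin_induction with
    | mem x hx => obtain ⟨j, rfl⟩ := hx; exact hg j
    | algebraMap x => simp
    | add x y _ _ hx hy => simp [hx, hy]
    | inv x _ hx => simp [hx]
    | mul x y _ _ hx hy => simp [hx, hy]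
  ext y
  exact key y (by rw [h]; trivial)

theorem ringChar_ext (x : L) : ringChar (Ext K x) = ringChar K :=
  (Algebra.ringChar_eq K (Ext K x)).symm

theorem conjRoot_ext (x y : L) : conjRoot (Ext K x) y = conjRoot K y := by
  simp [conjRoot, ringChar_ext]

theorem algEquiv_apply_ext {g : L ≃ₐ[K] L} {x : L} (hg : g x = x) (w : Ext K x) :
    g (w : L) = w := by
  have key : ∀ y ∈ IntermediateField.adjoin K ({x} : Set L), g y = y := by
    intro y hy
    induction hy using IntermediateField.adjoin_induction with
    | mem x hx => rw [Set.mem_singleton_iff.1 hx]; exact hg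
    | algebraMap x => simp
    | add x y _ _ hx hy => simp [hx, hy]
    | inv x _ hx => simp [hx]
    | mul x y _ _ hx hy => simp [hx, hy]
  exact key w w.2

/-- An automorphism of `L/K` that fixes `x`, as an automorphism of `L/K(x)`. -/
def extAut (x : L) (g : L ≃ₐ[K] L) (hg : g x = x) : L ≃ₐ[Ext K x] L :=
  AlgEquiv.ofRingEquiv (f := (g : L ≃+* L)) fun w => algEquiv_apply_ext hg w

@[simp] theorem extAut_apply (x : L) (g : L ≃ₐ[K] L) (hg : g x = x) (y : L) :
    extAut x g hg y = g y := rfl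

@[simp] theorem restrictScalars_extAut (x : L) (g : L ≃ₐ[K] L) (hg : g x = x) :
    (extAut x g hg).restrictScalars K = g := by
  ext; rfl

namespace IsMultiquadratic

variable {m : ℕ}

/-- It suffices to compare on the generators, where each automorphism either does nothing or applies
`conjRoot`, an operation that all automorphisms respect. -/
theorem commute {c : (L ≃ₐ[K] L) → (Fin m → ZMod 2)} {a : Fin m → K} {α : Fin m → L}
    (h : IsMultiquadratic K c a α) (g g' : L ≃ₐ[K] L) (y : L) : g (g' y) = g' (g y) := by
  have : g * g' = g' * g := by
    refine algEquiv_ext_of_adjoin h.adjoin_eq_top fun j => ?_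
    simp only [AlgEquiv.mul_apply]
    rw [h.act g j, h.act g' j]
    split_ifs <;> simp_all [map_conjRoot, h.act]
  exact DFunLike.congr_fun this y

variable {c : (L ≃ₐ[K] L) → (Fin (m + 1) → ZMod 2)} {a : Fin (m + 1) → K} {α : Fin (m + 1) → L}

theorem apply_last_eq_iff (h : IsMultiquadratic K c a α) (g : L ≃ₐ[K] L) :
    g (α (Fin.last m)) = α (Fin.last m) ↔ c g (Fin.last m) = 0 := by
  rw [h.act]
  split_ifs with h0
  · simp [h0]
  · simp [h0, h.conj_ne]

theorem ext (h : IsMultiquadratic K c a α) :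
    IsMultiquadratic (Ext K (α (Fin.last m))) (initCoord K (α (Fin.last m)) c)
      (fun i => algebraMap K (Ext K (α (Fin.last m))) (a i.castSucc)) (Fin.init α) where
  adjoin_eq_top := by
    rw [← IntermediateField.restrictScalars_eq_top_iff (K := K),
      IntermediateField.adjoin_adjoin_left, ← h.adjoin_eq_top]
    congr 1
    ext y
    simp only [Set.singleton_union, Set.mem_insert_iff, Set.mem_range]
    constructor
    · rintro (rfl | ⟨j, rfl⟩)
      · exact ⟨_, rfl⟩
      · exact ⟨_, rfl⟩
    · rintro ⟨j, rfl⟩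
      induction j using Fin.lastCases with
      | last => exact Or.inl rfl
      | cast j => exact Or.inr ⟨j, rfl⟩
  root j := by
    rw [ringChar_ext]
    exact h.root j.castSucc
  act g j := by
    rw [conjRoot_ext]
    exact h.act (g.restrictScalars K) j.castSucc
  surj v := by
    -- A last coordinate `0` means that `g` fixes the last generator, hence is linear over the
    -- larger field.
    obtain ⟨g, hg⟩ := h.surj (Fin.snoc v 0)
    refine ⟨extAut (α (Fin.last m)) g ((h.apply_last_eq_iff g).2 (by simp [hg])), ?_⟩
    simp [initCoord, hg]
  conj_ne j := by
    rw [conjRoot_ext]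
    exact h.conj_ne j.castSucc

theorem exists_theta (h : IsMultiquadratic K c a α) :
    ∃ θ : L ≃ₐ[K] L, θ (α (Fin.last m)) = conjRoot K (α (Fin.last m)) ∧
      ∀ j : Fin m, θ (α j.castSucc) = α j.castSucc := by
  obtain ⟨θ, hθ⟩ := h.surj (Pi.single (Fin.last m) 1)
  exact ⟨θ, by simp [h.act, hθ], fun j => by simp [h.act, hθ]⟩

/-- Subtracting the relation from its image under `θ` leaves `q` times the difference of two
distinct roots. -/
theorem ne_zero_of_last (h : IsMultiquadratic K c a α) {p q : K}
    (hpq : algebraMap K L p + algebraMap K L q * α (Fin.last m) = 0) : p = 0 ∧ q = 0 := by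
  obtain ⟨θ, hθ, -⟩ := h.exists_theta
  have h1 := congrArg θ hpq
  simp only [map_add, map_mul, AlgEquiv.commutes, map_zero, hθ] at h1
  have h2 : algebraMap K L q * (conjRoot K (α (Fin.last m)) - α (Fin.last m)) = 0 := by
    linear_combination h1 - hpq
  have hq : q = 0 := by
    simpa [sub_eq_zero, h.conj_ne] using h2
  simpa [hq] using hpq

theorem gen_ne_zero (h : IsMultiquadratic K c a α) : Ext.gen K (α (Fin.last m)) ≠ 0 := by
  intro h0
  have h1 : α (Fin.last m) = 0 := congrArg Subtype.val h0
  have := h.ne_zero_of_last (p := 0) (q := 1) (by simp [h1])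
  simp at this

theorem gen_root (h : IsMultiquadratic K c a α) :
    if ringChar K = 2 then Ext.gen K (α (Fin.last m)) ^ 2 + Ext.gen K (α (Fin.last m)) =
      algebraMap K _ (a (Fin.last m))
    else Ext.gen K (α (Fin.last m)) ^ 2 = algebraMap K _ (a (Fin.last m)) := by
  have h1 := h.root (Fin.last m)
  split_ifs at h1 ⊢ <;> exact Subtype.ext h1

theorem exists_eq_add (h : IsMultiquadratic K c a α) (w : Ext K (α (Fin.last m))) :
    ∃ p q : K, w = algebraMap K _ p + algebraMap K _ q * Ext.gen K (α (Fin.last m)) := by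
  obtain ⟨x, hx⟩ : ∃ x, x = α (Fin.last m) := ⟨_, rfl⟩
  have hroot : ∃ u v : K, x * x = algebraMap K L u + algebraMap K L v * x := by
    have := h.root (Fin.last m)
    split_ifs at this
    · exact ⟨a (Fin.last m), -1, by rw [← this, ← hx]; simp; ring⟩
    · exact ⟨a (Fin.last m), 0, by rw [← this, ← hx]; simp; ring⟩
  obtain ⟨u, v, huv⟩ := hroot
  have hint : IsIntegral K x := by
    refine ⟨Polynomial.X ^ 2 - (Polynomial.C v * Polynomial.X + Polynomial.C u), ?_, ?_⟩
    · exact Polynomial.monic_X_pow_sub (lt_of_le_of_lt Polynomial.degree_linear_le (by norm_num))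
    · simp only [Polynomial.eval₂_sub, Polynomial.eval₂_pow, Polynomial.eval₂_X,
        Polynomial.eval₂_add, Polynomial.eval₂_mul, Polynomial.eval₂_C]
      linear_combination huv
  -- Since `x` is integral, `K(x) = K[x]`; the quadratic relation then reduces every polynomial in
  -- `x` to degree at most one.
  have key : ∀ y ∈ Algebra.adjoin K ({x} : Set L),
      ∃ p q : K, y = algebraMap K L p + algebraMap K L q * x := by
    intro y hy
    induction hy using Algebra.adjoin_induction with
    | mem y hy => exact ⟨0, 1, by simp [Set.mem_singleton_iff.1 hy]⟩
    | algebraMap r => exact ⟨r, 0, by simp⟩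
    | add y z _ _ hy hz =>
      obtain ⟨p, q, rfl⟩ := hy
      obtain ⟨p', q', rfl⟩ := hz
      exact ⟨p + p', q + q', by simp; ring⟩
    | mul y z _ _ hy hz =>
      obtain ⟨p, q, rfl⟩ := hy
      obtain ⟨p', q', rfl⟩ := hz
      refine ⟨p * p' + q * q' * u, p * q' + q * p' + q * q' * v, ?_⟩
      simp only [map_add, map_mul]
      linear_combination (algebraMap K L q * algebraMap K L q') * huv
  have hw : (w : L) ∈ Algebra.adjoin K ({x} : Set L) := by
    rw [← IntermediateField.adjoin_simple_toSubalgebra_of_isAlgebraic hint.isAlgebraic]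
    rw [hx]
    exact w.2
  obtain ⟨p, q, hpq⟩ := key _ hw
  rw [hx] at hpq
  exact ⟨p, q, Subtype.ext hpq⟩

theorem ext_add_inj (h : IsMultiquadratic K c a α) {p q : K}
    (hpq : algebraMap K (Ext K (α (Fin.last m))) p +
      algebraMap K _ q * Ext.gen K (α (Fin.last m)) = 0) : p = 0 ∧ q = 0 :=
  h.ne_zero_of_last (congrArg Subtype.val hpq)

end IsMultiquadratic

theorem toVec_apply {m : ℕ} (α : Fin m → L) (X : SqMat m K) (j : Idx m) :
    toVec K α X j = ∑ i, algebraMap K L (X i j) * basisFam m α i := by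
  simp [toVec, Algebra.smul_def]

theorem basisFam_inl {m : ℕ} (α : Fin (m + 1) → L) (i : Idx m) :
    basisFam (m + 1) α (Sum.inl i : Idx m ⊕ Idx m) = basisFam m (Fin.init α) i := rfl

theorem basisFam_inr {m : ℕ} (α : Fin (m + 1) → L) (i : Idx m) :
    basisFam (m + 1) α (Sum.inr i : Idx m ⊕ Idx m) =
      basisFam m (Fin.init α) i * α (Fin.last m) := rfl

theorem sum_idx_succ {m : ℕ} {M : Type*} [AddCommMonoid M] (f : Idx (m + 1) → M) :
    ∑ i, f i = ∑ i : Idx m, f (Sum.inl i : Idx m ⊕ Idx m) +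
      ∑ i : Idx m, f (Sum.inr i : Idx m ⊕ Idx m) :=
  Fintype.sum_sum_type f

theorem basisFam_fixed {F : Type*} [FunLike F L L] [RingHomClass F L L] (θ : F) :
    ∀ {m : ℕ} {α : Fin m → L}, (∀ j, θ (α j) = α j) →
      ∀ i, θ (basisFam m α i) = basisFam m α i
  | 0, _, _, _ => map_one θ
  | m + 1, α, h, Sum.inl i => basisFam_fixed θ (α := Fin.init α) (fun j => h j.castSucc) i
  | m + 1, α, h, Sum.inr i => by
    have := basisFam_fixed θ (α := Fin.init α) (fun j => h j.castSucc) i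
    rw [basisFam_inr, map_mul, this, h]

theorem IsMultiquadratic.basisFam_injective : ∀ {m : ℕ} (K : Type u) [Field K] [Algebra K L]
    {c : (L ≃ₐ[K] L) → (Fin m → ZMod 2)} {a : Fin m → K} {α : Fin m → L},
    IsMultiquadratic K c a α → ∀ w : Idx m → K,
      ∑ i, algebraMap K L (w i) * basisFam m α i = 0 → w = 0
  | 0, K, _, _, c, a, α, h, w, hw => by
    have h1 : algebraMap K L (w ()) * 1 = 0 := by
      rw [← hw]
      exact (Fintype.sum_unique (ι := Unit) fun i => algebraMap K L (w i) * 1).symm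
    funext i
    change w () = 0
    simpa using h1
  | m + 1, K, _, _, c, a, α, h, w, hw => by
    -- The two halves of the coordinates are paired into coefficients `p + q x` over `K(x)`, to
    -- which the induction hypothesis applies.
    have h1 := basisFam_injective (Ext K (α (Fin.last m))) h.ext
      (fun i => algebraMap K _ (w (Sum.inl i : Idx m ⊕ Idx m)) +
        algebraMap K _ (w (Sum.inr i : Idx m ⊕ Idx m)) * Ext.gen K (α (Fin.last m))) (by
        rw [sum_idx_succ] at hw
        rw [← hw, ← Finset.sum_add_distrib]
        refine Finset.sum_congr rfl fun i _ => ?_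
        rw [basisFam_inl, basisFam_inr, map_add, map_mul]
        change (algebraMap K L _ + algebraMap K L _ * α (Fin.last m)) * _ = _
        ring)
    have h2 : ∀ i, _ := fun i => h.ext_add_inj (congrFun h1 i)
    funext i
    rcases i with i | i
    · exact (h2 i).1
    · exact (h2 i).2

theorem IsMultiquadratic.basisFam_surjective : ∀ {m : ℕ} (K : Type u) [Field K] [Algebra K L]
    {c : (L ≃ₐ[K] L) → (Fin m → ZMod 2)} {a : Fin m → K} {α : Fin m → L},
    IsMultiquadratic K c a α → ∀ y : L, ∃ w : Idx m → K,
      y = ∑ i, algebraMap K L (w i) * basisFam m α i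
  | 0, K, _, _, c, a, α, h, y => by
    have h1 : y ∈ IntermediateField.adjoin K (Set.range α) := by
      rw [h.adjoin_eq_top]; trivial
    rw [Set.range_eq_empty, IntermediateField.adjoin_empty, IntermediateField.mem_bot] at h1
    obtain ⟨w, rfl⟩ := h1
    refine ⟨fun _ => w, ?_⟩
    change _ = ∑ i : Unit, algebraMap K L w * 1
    simp
  | m + 1, K, _, _, c, a, α, h, y => by
    obtain ⟨w, hw⟩ := basisFam_surjective (Ext K (α (Fin.last m))) h.ext y
    choose p q hpq using fun i => h.exists_eq_add (w i)
    refine ⟨fun i => Sum.elim p q i, ?_⟩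
    rw [hw, sum_idx_succ, ← Finset.sum_add_distrib]
    refine Finset.sum_congr rfl fun i _ => ?_
    rw [basisFam_inl, basisFam_inr, hpq, map_add, map_mul]
    change (algebraMap K L (p i) + algebraMap K L (q i) * α (Fin.last m)) * _ =
      algebraMap K L (p i) * _ + algebraMap K L (q i) * _
    ring

theorem IsMultiquadratic.toVec_injective {m : ℕ} {c : (L ≃ₐ[K] L) → (Fin m → ZMod 2)}
    {a : Fin m → K} {α : Fin m → L} (h : IsMultiquadratic K c a α) :
    Function.Injective (toVec K α : SqMat m K → Idx m → L) := by
  intro X Y hXY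
  ext i j
  have h1 := congrFun hXY j
  rw [toVec_apply, toVec_apply, ← sub_eq_zero, ← Finset.sum_sub_distrib] at h1
  have h2 := h.basisFam_injective K (fun i => X i j - Y i j) (by
    rw [← h1]
    exact Finset.sum_congr rfl fun i _ => by rw [map_sub, sub_mul])
  exact sub_eq_zero.1 (congrFun h2 i)

theorem IsMultiquadratic.toVec_surjective {m : ℕ} {c : (L ≃ₐ[K] L) → (Fin m → ZMod 2)}
    {a : Fin m → K} {α : Fin m → L} (h : IsMultiquadratic K c a α) :
    Function.Surjective (toVec K α : SqMat m K → Idx m → L) := by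
  intro v
  choose w hw using fun j => h.basisFam_surjective K (v j)
  exact ⟨Matrix.of fun i j => w j i, funext fun j => by rw [toVec_apply, hw j]; rfl⟩

end Multiquadratic

/-! ### Recursive structure of the codes -/

section Structure

variable (K : Type u) {L : Type u} [Field K] [Field L] [Algebra K L]

/-- The code `RM(r, m)` as a space of endomorphisms. -/
def RMend {m : ℕ} (c : (L ≃ₐ[K] L) → (Fin m → ZMod 2)) (r : ℤ) : Submodule L (L →ₗ[K] L) :=
  (RM K c r).map (toEnd K)

variable {K}

theorem toEnd_single (g : L ≃ₐ[K] L) (l : L) :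
    toEnd K (SkewMonoidAlgebra.single g l) = l • g.toLinearMap := by
  simp [toEnd, SkewMonoidAlgebra.coeffLinearEquiv]

/-- This reduces statements about codewords that are stable under `L`-linear combinations to single
automorphisms, through `RMend_induction`. -/
theorem RMend_eq_span {m : ℕ} (c : (L ≃ₐ[K] L) → (Fin m → ZMod 2)) (r : ℤ) :
    RMend K c r =
      Submodule.span L {φ | ∃ g : L ≃ₐ[K] L, (hammingNorm (c g) : ℤ) ≤ r ∧ g.toLinearMap = φ} := by
  apply le_antisymm
  · rintro _ ⟨f, hf, rfl⟩
    rw [← f.sum_single, SkewMonoidAlgebra.sum_def, Finsupp.sum, map_sum]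
    refine Submodule.sum_mem _ fun g hg => ?_
    rw [toEnd_single]
    exact Submodule.smul_mem _ _ (Submodule.subset_span
      ⟨g, hf g (Finsupp.mem_support_iff.1 hg), rfl⟩)
  · rw [Submodule.span_le]
    rintro _ ⟨g, hg, rfl⟩
    refine ⟨SkewMonoidAlgebra.single g 1, fun g' hg' => ?_, by simp [toEnd_single]⟩
    rw [SkewMonoidAlgebra.coeff_single] at hg'
    rwa [← (Finsupp.single_apply_ne_zero.1 hg').1] at hg

theorem toLinearMap_mem_RMend {m : ℕ} {c : (L ≃ₐ[K] L) → (Fin m → ZMod 2)} {r : ℤ}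
    {g : L ≃ₐ[K] L} (hg : (hammingNorm (c g) : ℤ) ≤ r) : g.toLinearMap ∈ RMend K c r := by
  rw [RMend_eq_span]
  exact Submodule.subset_span ⟨g, hg, rfl⟩

theorem RMend_induction {m : ℕ} {c : (L ≃ₐ[K] L) → (Fin m → ZMod 2)} {r : ℤ}
    {p : (L →ₗ[K] L) → Prop}
    (aut : ∀ g : L ≃ₐ[K] L, (hammingNorm (c g) : ℤ) ≤ r → p g.toLinearMap)
    (zero : p 0) (add : ∀ φ ψ, p φ → p ψ → p (φ + ψ)) (smul : ∀ (l : L) φ, p φ → p (l • φ))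
    {φ : L →ₗ[K] L} (hφ : φ ∈ RMend K c r) : p φ := by
  rw [RMend_eq_span] at hφ
  induction hφ using Submodule.span_induction with
  | mem φ h => obtain ⟨g, hg, rfl⟩ := h; exact aut g hg
  | zero => exact zero
  | add φ ψ _ _ h h' => exact add φ ψ h h'
  | smul l φ _ h => exact smul l φ h

theorem mem_RMmat_iff {m : ℕ} {c : (L ≃ₐ[K] L) → (Fin m → ZMod 2)} {α : Fin m → L} {r : ℤ}
    {X : SqMat m K} :
    X ∈ RMmat K c α r ↔ ∃ φ ∈ RMend K c r, ∀ j, φ (basisFam m α j) = toVec K α X j := by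
  constructor
  · rintro ⟨f, hf, h⟩
    exact ⟨_, ⟨f, hf, rfl⟩, h⟩
  · rintro ⟨_, ⟨f, hf, rfl⟩, h⟩
    exact ⟨f, hf, h⟩

theorem mem_RMmat_iff_toVec {m : ℕ} {c : (L ≃ₐ[K] L) → (Fin m → ZMod 2)} {α : Fin m → L}
    {r : ℤ} {X : SqMat m K} : X ∈ RMmat K c α r ↔ toVec K α X ∈ RMvec K c α r := by
  constructor
  · rintro ⟨f, hf, h⟩
    exact ⟨f, hf, funext h⟩
  · rintro ⟨f, hf, h⟩
    exact ⟨f, hf, fun j => congrFun h j⟩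

theorem RMend_of_neg {m : ℕ} {c : (L ≃ₐ[K] L) → (Fin m → ZMod 2)} {r : ℤ} (hr : r < 0)
    {φ : L →ₗ[K] L} (hφ : φ ∈ RMend K c r) : φ = 0 := by
  refine RMend_induction (p := fun φ => φ = 0) (fun g hg => by omega) rfl ?_ ?_ hφ
  · rintro _ _ rfl rfl; simp
  · rintro l _ rfl; simp

theorem hammingNorm_eq_init_add {m : ℕ} (v : Fin (m + 1) → ZMod 2) :
    hammingNorm v = hammingNorm (Fin.init v) + if v (Fin.last m) = 0 then 0 else 1 := by
  simp only [hammingNorm, Finset.card_filter, Fin.sum_univ_castSucc, ne_eq, ite_not]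
  rfl

theorem toVec_succ {m : ℕ} (α : Fin (m + 1) → L) (X : BlockMat m K) (j : Idx m ⊕ Idx m) :
    toVec K (m := m + 1) α X j =
      ∑ i, (algebraMap K L (X (Sum.inl i) j) + algebraMap K L (X (Sum.inr i) j) *
        α (Fin.last m)) * basisFam m (Fin.init α) i := by
  refine (toVec_apply (m := m + 1) α X j).trans ((sum_idx_succ _).trans ?_)
  rw [← Finset.sum_add_distrib]
  refine Finset.sum_congr rfl fun i _ => ?_
  rw [basisFam_inl, basisFam_inr]
  ring

namespace IsMultiquadratic

theorem eq_zero_of_neg {m : ℕ} {c : (L ≃ₐ[K] L) → (Fin m → ZMod 2)} {a : Fin m → K}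
    {α : Fin m → L} (h : IsMultiquadratic K c a α) {r : ℤ} (hr : r < 0) {X : SqMat m K}
    (hX : X ∈ RMmat K c α r) : X = 0 := by
  obtain ⟨φ, hφ, hX⟩ := mem_RMmat_iff.1 hX
  apply h.toVec_injective
  funext j
  rw [← hX, RMend_of_neg hr hφ, toVec_apply]
  simp

variable {m : ℕ} {c : (L ≃ₐ[K] L) → (Fin (m + 1) → ZMod 2)} {a : Fin (m + 1) → K}
  {α : Fin (m + 1) → L}

/-- An automorphism moving the last generator factors as `g' θ` with `g'` fixing it. Clearing the
last coordinate lowers the weight by one, which explains the order `r - 1` of `φ₁`. -/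
theorem exists_split (h : IsMultiquadratic K c a α) {θ : L ≃ₐ[K] L}
    (hθ : θ (α (Fin.last m)) = conjRoot K (α (Fin.last m)))
    (hθ' : ∀ j : Fin m, θ (α j.castSucc) = α j.castSucc) {r : ℤ} {φ : L →ₗ[K] L}
    (hφ : φ ∈ RMend K c r) :
    ∃ φ₀ ∈ RMend (Ext K (α (Fin.last m))) (initCoord K (α (Fin.last m)) c) r,
    ∃ φ₁ ∈ RMend (Ext K (α (Fin.last m))) (initCoord K (α (Fin.last m)) c) (r - 1),
      ∀ y, φ y = φ₀ y + φ₁ (θ y) := by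
  refine RMend_induction (p := fun φ =>
    ∃ φ₀ ∈ RMend (Ext K (α (Fin.last m))) (initCoord K (α (Fin.last m)) c) r,
    ∃ φ₁ ∈ RMend (Ext K (α (Fin.last m))) (initCoord K (α (Fin.last m)) c) (r - 1),
      ∀ y, φ y = φ₀ y + φ₁ (θ y)) ?_ ?_ ?_ ?_ hφ
  · intro g hg
    rw [hammingNorm_eq_init_add] at hg
    by_cases h0 : c g (Fin.last m) = 0
    · refine ⟨(extAut _ g ((h.apply_last_eq_iff g).2 h0)).toLinearMap, toLinearMap_mem_RMend ?_,
        0, zero_mem _, fun y => by simp⟩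
      simpa [initCoord, h0] using hg
    · obtain ⟨g', hg'⟩ := h.surj (Fin.snoc (Fin.init (c g)) 0)
      have hlast : g' (α (Fin.last m)) = α (Fin.last m) :=
        (h.apply_last_eq_iff g').2 (by simp [hg'])
      have hgg : g = g' * θ := by
        refine algEquiv_ext_of_adjoin h.adjoin_eq_top fun j => ?_
        rw [AlgEquiv.mul_apply]
        induction j using Fin.lastCases with
        | last => rw [hθ, map_conjRoot, hlast, h.act, if_neg h0]
        | cast j =>
          rw [hθ', h.act, h.act, hg']
          simp [Fin.init]
      refine ⟨0, zero_mem _, (extAut _ g' hlast).toLinearMap, toLinearMap_mem_RMend ?_,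
        fun y => by simp [hgg]⟩
      simp only [initCoord, restrictScalars_extAut, hg', Fin.init_snoc]
      simp only [h0, if_false] at hg
      push_cast at hg
      linarith
  · exact ⟨0, zero_mem _, 0, zero_mem _, fun y => by simp⟩
  · rintro φ ψ ⟨φ₀, h₀, φ₁, h₁, hφ⟩ ⟨ψ₀, k₀, ψ₁, k₁, hψ⟩
    refine ⟨φ₀ + ψ₀, add_mem h₀ k₀, φ₁ + ψ₁, add_mem h₁ k₁, fun y => ?_⟩
    simp only [LinearMap.add_apply, hφ, hψ]
    ring
  · rintro l φ ⟨φ₀, h₀, φ₁, h₁, hφ⟩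
    refine ⟨l • φ₀, Submodule.smul_mem _ _ h₀, l • φ₁, Submodule.smul_mem _ _ h₁, fun y => ?_⟩
    simp only [LinearMap.smul_apply, hφ, smul_add]

/-- Conjugation by `θ` acts on the coefficients only: the Galois group is commutative, so the
support, and with it the order, is preserved. This is needed because `combineA` involves the
conjugate of `x` rather than `x`. -/
theorem exists_conj (h : IsMultiquadratic K c a α) (θ : L ≃ₐ[K] L) {r : ℤ}
    {φ : L →ₗ[Ext K (α (Fin.last m))] L}
    (hφ : φ ∈ RMend (Ext K (α (Fin.last m))) (initCoord K (α (Fin.last m)) c) r) :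
    ∃ ψ ∈ RMend (Ext K (α (Fin.last m))) (initCoord K (α (Fin.last m)) c) r,
      ∀ y, θ y = y → ψ y = θ (φ y) := by
  refine RMend_induction (p := fun φ =>
    ∃ ψ ∈ RMend (Ext K (α (Fin.last m))) (initCoord K (α (Fin.last m)) c) r,
      ∀ y, θ y = y → ψ y = θ (φ y)) ?_ ?_ ?_ ?_ hφ
  · intro g hg
    refine ⟨_, toLinearMap_mem_RMend hg, fun y hy => ?_⟩
    have := h.commute θ (g.restrictScalars K) y
    rw [hy] at this
    exact this.symm
  · exact ⟨0, zero_mem _, fun y _ => by simp⟩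
  · rintro φ φ' ⟨ψ, hψ, h1⟩ ⟨ψ', hψ', h2⟩
    exact ⟨ψ + ψ', add_mem hψ hψ', fun y hy => by simp [h1 y hy, h2 y hy]⟩
  · rintro l φ ⟨ψ, hψ, h1⟩
    exact ⟨θ l • ψ, Submodule.smul_mem _ _ hψ, fun y hy => by simp [h1 y hy]⟩

theorem exists_matrices (h : IsMultiquadratic K c a α)
    (φ : L →ₗ[Ext K (α (Fin.last m))] L) :
    ∃ P Q : SqMat m K, ∀ j, φ (basisFam m (Fin.init α) j) =
      ∑ i, (algebraMap K L (P i j) + algebraMap K L (Q i j) * α (Fin.last m)) *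
        basisFam m (Fin.init α) i := by
  obtain ⟨M, hM⟩ := h.ext.toVec_surjective fun j => φ (basisFam m (Fin.init α) j)
  choose P Q hPQ using fun i j => h.exists_eq_add (M i j)
  refine ⟨P, Q, fun j => ?_⟩
  rw [← congrFun hM j, toVec_apply]
  refine Finset.sum_congr rfl fun i _ => ?_
  rw [hPQ]
  rfl

/-- The recursive structure of the codes. -/
theorem exists_assemble (h : IsMultiquadratic K c a α) {r : ℤ} {C : SqMat (m + 1) K}
    (hC : C ∈ RMmat K c α r) :
    ∃ A₀ A₁ B₀ B₁ : SqMat m K, C = assemble K (a (Fin.last m)) A₀ A₁ B₀ B₁ ∧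
      combineA K (α (Fin.last m)) A₀ A₁ ∈ RMmat (Ext K (α (Fin.last m)))
        (initCoord K (α (Fin.last m)) c) (Fin.init α) r ∧
      combineB K (α (Fin.last m)) B₀ B₁ ∈ RMmat (Ext K (α (Fin.last m)))
        (initCoord K (α (Fin.last m)) c) (Fin.init α) (r - 1) := by
  obtain ⟨φ, hφ, hC⟩ := mem_RMmat_iff.1 hC
  obtain ⟨θ, hθ, hθ'⟩ := h.exists_theta
  obtain ⟨φ₀, h₀, φ₁, h₁, hsplit⟩ := h.exists_split hθ hθ' hφ
  obtain ⟨ψ, hψ, hconj⟩ := h.exists_conj θ h₀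
  obtain ⟨A₀, A₁, hA⟩ := h.exists_matrices φ₀
  obtain ⟨B₀, B₁, hB⟩ := h.exists_matrices φ₁
  have hbas : ∀ i, θ (basisFam m (Fin.init α) i) = basisFam m (Fin.init α) i :=
    basisFam_fixed θ hθ'
  have hroot := h.root (Fin.last m)
  have hlin : ∀ (χ : L →ₗ[Ext K (α (Fin.last m))] L) y,
      χ (y * α (Fin.last m)) = α (Fin.last m) * χ y := fun χ y => by
    rw [mul_comm]
    exact χ.map_smul (Ext.gen K (α (Fin.last m))) y
  have hne : α (Fin.last m) ≠ 0 := fun h0 => h.gen_ne_zero (Subtype.ext h0)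
  have hgen : algebraMap (Ext K (α (Fin.last m))) L (Ext.gen K (α (Fin.last m))) =
    α (Fin.last m) := rfl
  have halg : ∀ q : K, algebraMap (Ext K (α (Fin.last m))) L
      (algebraMap K (Ext K (α (Fin.last m))) q) = algebraMap K L q := fun _ => rfl
  refine ⟨A₀, A₁, B₀, B₁, ?_, ?_, ?_⟩
  -- On a basis element `b` the value is `φ₀ b + φ₁ b`. On `b x` it is `x φ₀ b + x' φ₁ b`, with `x'`
  -- the conjugate of `x`. Reducing by the quadratic equation gives the two block columns.
  · apply h.toVec_injective
    funext j
    rw [← hC, hsplit]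
    refine Eq.trans ?_ (toVec_succ α _ j).symm
    rcases j with j | j
    · rw [basisFam_inl, hbas, hA, hB, ← Finset.sum_add_distrib]
      refine Finset.sum_congr rfl fun i _ => ?_
      unfold assemble
      split_ifs <;> simp only [Matrix.fromBlocks_apply₁₁, Matrix.fromBlocks_apply₂₁,
        Matrix.add_apply, map_add] <;> ring
    · rw [basisFam_inr, map_mul θ, hbas, hθ]
      unfold assemble conjRoot
      split_ifs with h2
      · rw [if_pos h2] at hroot
        rw [mul_add, mul_one, map_add, hlin, hlin, hA, hB, Finset.mul_sum, Finset.mul_sum,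
          ← Finset.sum_add_distrib, ← Finset.sum_add_distrib]
        refine Finset.sum_congr rfl fun i _ => ?_
        simp only [Matrix.fromBlocks_apply₁₂, Matrix.fromBlocks_apply₂₂,
          Matrix.add_apply, map_add, map_mul, Matrix.smul_apply, smul_eq_mul, ← hroot]
        have : CharP K 2 := ringChar.of_eq h2
        have : CharP L 2 := charP_of_injective_algebraMap (algebraMap K L).injective 2
        have h2 : (2 : L) = 0 := CharTwo.two_eq_zero
        linear_combination (-(algebraMap K L (A₁ i j)) * α (Fin.last m) *
          basisFam m (Fin.init α) i) * h2
      · rw [if_neg h2] at hroot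
        rw [mul_neg, map_neg, hlin, hlin, hA, hB, Finset.mul_sum, Finset.mul_sum,
          ← Finset.sum_neg_distrib, ← Finset.sum_add_distrib]
        refine Finset.sum_congr rfl fun i _ => ?_
        simp only [Matrix.fromBlocks_apply₁₂, Matrix.fromBlocks_apply₂₂,
          Matrix.sub_apply, map_sub, map_mul, Matrix.smul_apply, smul_eq_mul, ← hroot]
        ring
  · have hψj : ∀ j, ψ (basisFam m (Fin.init α) j) =
        ∑ i, (algebraMap K L (A₀ i j) + algebraMap K L (A₁ i j) *
          conjRoot K (α (Fin.last m))) * basisFam m (Fin.init α) i := fun j => by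
      rw [hconj _ (hbas j), hA, map_sum]
      refine Finset.sum_congr rfl fun i _ => ?_
      rw [map_mul, hbas, map_add, map_mul, hθ, AlgEquiv.commutes, AlgEquiv.commutes]
    rw [mem_RMmat_iff]
    -- With `x'` the conjugate of `x`, `combineA` is `A₀ + x' A₁` scaled by `x⁻¹` in characteristic
    -- two and by `-x⁻¹` otherwise; the code is `L`-linear, so the scalar is harmless.
    by_cases h2 : ringChar K = 2
    · refine ⟨(α (Fin.last m))⁻¹ • ψ, Submodule.smul_mem _ _ hψ, fun j => ?_⟩
      rw [LinearMap.smul_apply, hψj, toVec_apply, smul_eq_mul, Finset.mul_sum]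
      refine Finset.sum_congr rfl fun i _ => ?_
      simp only [combineA, conjRoot, if_pos h2, liftMat, Matrix.add_apply, Matrix.smul_apply,
        Matrix.map_apply, smul_eq_mul, map_add, map_mul, map_inv₀, hgen, halg]
      field_simp
      ring
    · refine ⟨(-(α (Fin.last m))⁻¹) • ψ, Submodule.smul_mem _ _ hψ, fun j => ?_⟩
      rw [LinearMap.smul_apply, hψj, toVec_apply, smul_eq_mul, Finset.mul_sum]
      refine Finset.sum_congr rfl fun i _ => ?_
      simp only [combineA, conjRoot, if_neg h2, liftMat, Matrix.sub_apply, Matrix.smul_apply,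
        Matrix.map_apply, smul_eq_mul, map_sub, map_mul, map_inv₀, hgen, halg]
      field_simp
      ring
  · rw [mem_RMmat_iff]
    -- Likewise `combineB` is `B₀ + x B₁` scaled by `x⁻¹`, respectively `2 x⁻¹`.
    by_cases h2 : ringChar K = 2
    · refine ⟨(α (Fin.last m))⁻¹ • φ₁, Submodule.smul_mem _ _ h₁, fun j => ?_⟩
      rw [LinearMap.smul_apply, hB, toVec_apply, smul_eq_mul, Finset.mul_sum]
      refine Finset.sum_congr rfl fun i _ => ?_
      simp only [combineB, if_pos h2, liftMat, Matrix.add_apply, Matrix.smul_apply,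
        Matrix.map_apply, smul_eq_mul, map_add, map_mul, map_inv₀, hgen, halg]
      field_simp
    · refine ⟨(2 * (α (Fin.last m))⁻¹) • φ₁, Submodule.smul_mem _ _ h₁, fun j => ?_⟩
      rw [LinearMap.smul_apply, hB, toVec_apply, smul_eq_mul, Finset.mul_sum]
      refine Finset.sum_congr rfl fun i _ => ?_
      simp only [combineB, if_neg h2, liftMat, Matrix.add_apply, Matrix.smul_apply,
        Matrix.map_apply, smul_eq_mul, map_add, map_mul, map_inv₀, hgen, halg, map_ofNat]
      field_simp

end IsMultiquadratic

end Structure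

/-! ### Row spaces and rank under field extension -/

section RowSpace

variable {K : Type u} [Field K]

theorem row_mem_rowSpace {m n : Type} (X : Matrix m n K) (i : m) : X i ∈ rowSpace K X :=
  Submodule.subset_span ⟨i, rfl⟩

theorem exists_rowSpace_eq {n : Type} [Finite n] (V : Submodule K (n → K)) :
    ∃ R : Matrix (Fin (Module.finrank K V)) n K, rowSpace K R = V := by
  refine ⟨Matrix.of fun i => (Module.finBasis K V i : n → K), ?_⟩
  have h1 := congrArg (Submodule.map V.subtype) (Module.finBasis K V).span_eq
  rw [Submodule.map_span, Submodule.map_top, Submodule.range_subtype, ← Set.range_comp] at h1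
  exact h1

theorem exists_eq_mul_of_rows_mem {l m n : Type} [Fintype l] {R : Matrix l n K}
    {X : Matrix m n K} (h : ∀ i, X i ∈ rowSpace K R) : ∃ Z : Matrix m l K, X = Z * R := by
  choose Z hZ using fun i => (Submodule.mem_span_range_iff_exists_fun K).1 (h i)
  refine ⟨Matrix.of Z, ?_⟩
  ext i j
  rw [← hZ i]
  simp [Matrix.mul_apply, Matrix.row]

theorem rowSpace_mul_le {l m n : Type} [Fintype m] (A : Matrix l m K) (B : Matrix m n K) :
    rowSpace K (A * B) ≤ rowSpace K B := by
  refine Submodule.span_le.2 ?_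
  rintro _ ⟨i, rfl⟩
  refine (Submodule.mem_span_range_iff_exists_fun K).2 ⟨A i, ?_⟩
  ext j
  simp [Matrix.mul_apply, Matrix.row]

theorem finrank_rowSpace {m n : Type} [Finite m] [Fintype n] (X : Matrix m n K) :
    Module.finrank K (rowSpace K X) = X.rank :=
  X.rank_eq_finrank_span_row.symm

/-- A factorization of `X` through a matrix with `X.rank` rows survives the change of field. -/
theorem rank_map_le {F : Type u} [Field F] (f : K →+* F) {m n : Type} [Finite m]
    [Fintype n] (X : Matrix m n K) : (X.map f).rank ≤ X.rank := by
  obtain ⟨R, hR⟩ := exists_rowSpace_eq (rowSpace K X)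
  obtain ⟨Z, hZ⟩ := exists_eq_mul_of_rows_mem (R := R) (X := X)
    fun i => hR.symm ▸ row_mem_rowSpace X i
  have hle : (X.map f).rank ≤ (R.map f).rank := by
    have h1 : X.map f = Z.map f * R.map f := by rw [← Matrix.map_mul, ← hZ]
    exact h1 ▸ Matrix.rank_mul_le_right _ _
  refine hle.trans ((Matrix.rank_le_card_height _).trans ?_)
  rw [Fintype.card_fin, finrank_rowSpace]

end RowSpace

/-! ### Folding and the minimum rank distance -/

section Fold

variable {K : Type u} {L : Type u} [Field K] [Field L] [Algebra K L]

theorem mul_rightFactor_apply {m : ℕ} {n : Type} (x : L)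
    (Z : Matrix n (Idx m ⊕ Idx m) (Ext K x)) (p : n) (j : Idx m) :
    (Z * rightFactor K m x) p j = Z p (Sum.inl j) - (Ext.gen K x)⁻¹ * Z p (Sum.inr j) := by
  simp [Matrix.mul_apply, rightFactor, Matrix.one_apply, mul_comm, sub_eq_add_neg]

theorem leftFactor_mul_apply {m : ℕ} {n : Type} (x : L)
    (Z : Matrix (Idx m ⊕ Idx m) n (Ext K x)) (i : Idx m) (j : n) :
    (leftFactor K m x * Z) i j = if ringChar K = 2 then
        Z (Sum.inl i) j + Ext.gen K x * Z (Sum.inr i) j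
      else (Ext.gen K x)⁻¹ * Z (Sum.inl i) j + Z (Sum.inr i) j := by
  unfold leftFactor
  split_ifs <;> simp [Matrix.mul_apply, Matrix.one_apply]

theorem liftMat_add {m n : Type} (x : L) (X Y : Matrix m n K) :
    liftMat K x (X + Y) = liftMat K x X + liftMat K x Y := by
  ext i j
  simp [liftMat]

theorem fold_add {m : ℕ} (x : L) (X Y : BlockMat m K) :
    fold K x (X + Y) = fold K x X + fold K x Y := by
  simp only [fold, liftMat_add, Matrix.mul_add, Matrix.add_mul]

theorem rank_fold_le {m : ℕ} (x : L) (X : BlockMat m K) : (fold K x X).rank ≤ X.rank :=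
  (Matrix.rank_mul_le_left _ _).trans ((Matrix.rank_mul_le_right _ _).trans (rank_map_le _ _))

theorem rank_liftMat_mul_rightFactor_le {m : ℕ} (x : L) (X : BlockMat m K) :
    (liftMat K x X * rightFactor K m x).rank ≤ X.rank :=
  (Matrix.rank_mul_le_left _ _).trans (rank_map_le _ _)

/-- The `K`-linear map `(u, v) ↦ μ (u + γ v)`. -/
def combineVec (m : ℕ) {x : L} (μ γ : Ext K x) :
    (Idx m ⊕ Idx m → K) →ₗ[K] (Idx m → Ext K x) where
  toFun u i := μ * (algebraMap K _ (u (Sum.inl i)) + γ * algebraMap K _ (u (Sum.inr i)))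
  map_add' u v := by
    ext i
    simp
    ring
  map_smul' s u := by
    funext i
    simp [Algebra.smul_def]
    ring

theorem lowerHalf_assemble {m : ℕ} (x : L) (a : K) (A₀ A₁ : SqMat m K) :
    lowerHalf (liftMat K x (assemble K a A₀ A₁ 0 0) * rightFactor K m x) =
      combineA K x A₀ A₁ := by
  refine Matrix.ext fun i j => ?_
  simp only [lowerHalf, Matrix.of_apply, mul_rightFactor_apply]
  unfold assemble combineA
  split_ifs with h2
  · have : CharP K 2 := ringChar.of_eq h2
    have : CharP (Ext K x) 2 := charP_of_injective_algebraMap (algebraMap K _).injective 2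
    simp [liftMat, CharTwo.sub_eq_add]
  · simp [liftMat]

theorem assemble_add {m : ℕ} (a : K) (A₀ A₁ B₀ B₁ : SqMat m K) :
    assemble K a A₀ A₁ B₀ B₁ = assemble K a A₀ A₁ 0 0 + assemble K a 0 0 B₀ B₁ := by
  unfold assemble
  split_ifs <;> simp [Matrix.fromBlocks_add, smul_add, add_assoc, sub_eq_add_neg]

namespace IsMultiquadratic

variable {m : ℕ} {c : (L ≃ₐ[K] L) → (Fin (m + 1) → ZMod 2)} {a : Fin (m + 1) → K}
  {α : Fin (m + 1) → L}

theorem ext_add_eq (h : IsMultiquadratic K c a α) {p q p' q' : K}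
    (hpq : algebraMap K (Ext K (α (Fin.last m))) p +
      algebraMap K _ q * Ext.gen K (α (Fin.last m)) =
      algebraMap K _ p' + algebraMap K _ q' * Ext.gen K (α (Fin.last m))) :
    p = p' ∧ q = q' := by
  have := h.ext_add_inj (p := p - p') (q := q - q') (by
    rw [map_sub, map_sub]
    linear_combination hpq)
  exact ⟨sub_eq_zero.1 this.1, sub_eq_zero.1 this.2⟩

theorem combineA_inj (h : IsMultiquadratic K c a α) {A₀ A₁ A₀' A₁' : SqMat m K}
    (hA : combineA K (α (Fin.last m)) A₀ A₁ = combineA K (α (Fin.last m)) A₀' A₁') :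
    A₀ = A₀' ∧ A₁ = A₁' := by
  have h0 := h.gen_ne_zero
  have key : ∀ i j, A₀ i j = A₀' i j ∧ A₁ i j = A₁' i j := fun i j => by
    have h1 := congrFun (congrFun hA i) j
    unfold combineA at h1
    split_ifs at h1
    · simp only [liftMat, Matrix.add_apply, Matrix.smul_apply, Matrix.map_apply, smul_eq_mul,
        map_add] at h1
      field_simp at h1
      have h2 := h.ext_add_eq (p := A₀ i j + A₁ i j) (q := A₁ i j) (p' := A₀' i j + A₁' i j)
        (q' := A₁' i j) (by rw [map_add, map_add]; linear_combination h1)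
      exact ⟨by linear_combination h2.1 - h2.2, h2.2⟩
    · simp only [liftMat, Matrix.sub_apply, Matrix.smul_apply, Matrix.map_apply, smul_eq_mul]
        at h1
      field_simp at h1
      have h2 := h.ext_add_eq (p := - A₀ i j) (q := A₁ i j) (p' := - A₀' i j)
        (q' := A₁' i j) (by rw [map_neg, map_neg]; linear_combination h1)
      exact ⟨neg_inj.1 h2.1, h2.2⟩
  exact ⟨Matrix.ext fun i j => (key i j).1, Matrix.ext fun i j => (key i j).2⟩

theorem combineB_inj (h : IsMultiquadratic K c a α) {B₀ B₁ B₀' B₁' : SqMat m K}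
    (hB : combineB K (α (Fin.last m)) B₀ B₁ = combineB K (α (Fin.last m)) B₀' B₁') :
    B₀ = B₀' ∧ B₁ = B₁' := by
  have h0 := h.gen_ne_zero
  have key : ∀ i j, B₀ i j = B₀' i j ∧ B₁ i j = B₁' i j := fun i j => by
    have h1 := congrFun (congrFun hB i) j
    unfold combineB at h1
    split_ifs at h1 with h2
    · simp only [liftMat, Matrix.add_apply, Matrix.smul_apply, Matrix.map_apply, smul_eq_mul] at h1
      field_simp at h1
      exact h.ext_add_eq (by linear_combination h1)
    · simp only [liftMat, Matrix.add_apply, Matrix.smul_apply, Matrix.map_apply, smul_eq_mul] at h1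
      have h2' : (2 : Ext K (α (Fin.last m))) ≠ 0 :=
        Ring.two_ne_zero (by rwa [ringChar_ext])
      refine h.ext_add_eq (mul_left_cancel₀ h2' ?_)
      field_simp at h1
      linear_combination 2 * h1
  exact ⟨Matrix.ext fun i j => (key i j).1, Matrix.ext fun i j => (key i j).2⟩

/-- The right factor sends the `A` part to the block column `(-x ; 1)` times `combineA` (`(x ; 1)`
in characteristic two), which the left factor kills. It sends the `B` part to a column whose two
halves add up under the left factor to `combineB`. -/
theorem fold_assemble (h : IsMultiquadratic K c a α) (A₀ A₁ B₀ B₁ : SqMat m K) :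
    fold K (α (Fin.last m)) (assemble K (a (Fin.last m)) A₀ A₁ B₀ B₁) =
      combineB K (α (Fin.last m)) B₀ B₁ := by
  have h0 := h.gen_ne_zero
  have hroot := h.gen_root
  refine Matrix.ext fun i j => ?_
  rw [fold, Matrix.mul_assoc, leftFactor_mul_apply, mul_rightFactor_apply, mul_rightFactor_apply]
  unfold assemble combineB
  split_ifs at hroot ⊢ with h2
  · have : CharP K 2 := ringChar.of_eq h2
    have : CharP (Ext K (α (Fin.last m))) 2 :=
      charP_of_injective_algebraMap (algebraMap K _).injective 2
    have h2 : (2 : Ext K (α (Fin.last m))) = 0 := CharTwo.two_eq_zero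
    simp only [liftMat, Matrix.map_apply, Matrix.fromBlocks_apply₁₁, Matrix.fromBlocks_apply₁₂,
      Matrix.fromBlocks_apply₂₁, Matrix.fromBlocks_apply₂₂, Matrix.add_apply, Matrix.smul_apply,
      smul_eq_mul, map_add, map_mul, ← hroot]
    field_simp
    linear_combination (-(Ext.gen K (α (Fin.last m)) * algebraMap K _ (A₁ i j) +
      Ext.gen K (α (Fin.last m)) * algebraMap K _ (B₁ i j) + algebraMap K _ (B₀ i j))) * h2
  · simp only [liftMat, Matrix.map_apply, Matrix.fromBlocks_apply₁₁, Matrix.fromBlocks_apply₁₂,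
      Matrix.fromBlocks_apply₂₁, Matrix.fromBlocks_apply₂₂, Matrix.add_apply, Matrix.smul_apply,
      Matrix.sub_apply, smul_eq_mul, map_add, map_sub, map_mul, ← hroot]
    field_simp
    ring

theorem finrank_ext (h : IsMultiquadratic K c a α) :
    Module.finrank K (Ext K (α (Fin.last m))) = 2 := by
  let f : (K × K) →ₗ[K] Ext K (α (Fin.last m)) :=
    LinearMap.coprod (Algebra.linearMap K _) (LinearMap.toSpanSingleton K _ (Ext.gen K _))
  have hf : ∀ p q, f (p, q) = algebraMap K _ p + algebraMap K _ q * Ext.gen K _ := fun p q => by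
    simp [f, Algebra.smul_def]
  have hbij : Function.Bijective f := by
    constructor
    · rintro ⟨p, q⟩ ⟨p', q'⟩ hpq
      rw [hf, hf] at hpq
      exact Prod.ext (h.ext_add_eq hpq).1 (h.ext_add_eq hpq).2
    · intro w
      obtain ⟨p, q, rfl⟩ := h.exists_eq_add w
      exact ⟨(p, q), hf p q⟩
  rw [← (LinearEquiv.ofBijective f hbij).finrank_eq]
  simp

theorem two_mul_rank_combineA_le (h : IsMultiquadratic K c a α) (A₀ A₁ : SqMat m K) :
    2 * (combineA K (α (Fin.last m)) A₀ A₁).rank ≤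
      (assemble K (a (Fin.last m)) A₀ A₁ 0 0).rank := by
  -- Here `γ` is the conjugate of `x` and `combineA` equals `μ (A₀ + γ A₁)`. Under `(u, v) ↦ u + γ
  -- v`, multiplication by `A₀ + γ A₁` becomes the assembled matrix with zero `B` part.
  obtain ⟨μ, γ, hsurj, hmul⟩ : ∃ μ γ : Ext K (α (Fin.last m)),
      Function.Surjective (combineVec (K := K) m 1 γ) ∧
      ∀ w, combineA K (α (Fin.last m)) A₀ A₁ *ᵥ combineVec m 1 γ w =
        combineVec m μ γ (assemble K (a (Fin.last m)) A₀ A₁ 0 0 *ᵥ w) := by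
    have h0 := h.gen_ne_zero
    have hroot := h.gen_root
    by_cases h2 : ringChar K = 2
    · rw [if_pos h2] at hroot
      refine ⟨(Ext.gen K _)⁻¹, Ext.gen K _ + 1, fun y => ?_, fun w => ?_⟩
      · choose p q hpq using fun i => h.exists_eq_add (y i)
        refine ⟨Sum.elim (fun i => p i - q i) q, funext fun i => ?_⟩
        simp only [combineVec, LinearMap.coe_mk, AddHom.coe_mk, Sum.elim_inl, Sum.elim_inr,
          map_sub, hpq]
        ring
      · have : CharP K 2 := ringChar.of_eq h2
        have : CharP (Ext K (α (Fin.last m))) 2 :=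
          charP_of_injective_algebraMap (algebraMap K _).injective 2
        have h2' : (2 : Ext K (α (Fin.last m))) = 0 := CharTwo.two_eq_zero
        funext i
        simp only [combineVec, LinearMap.coe_mk, AddHom.coe_mk, Matrix.mulVec, dotProduct,
          Fintype.sum_sum_type, map_add, map_sum, Finset.mul_sum, mul_add,
          ← Finset.sum_add_distrib]
        refine Finset.sum_congr rfl fun j _ => ?_
        simp only [combineA, assemble, if_pos h2, liftMat, Matrix.fromBlocks_apply₁₁,
          Matrix.fromBlocks_apply₁₂, Matrix.fromBlocks_apply₂₁, Matrix.fromBlocks_apply₂₂,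
          Matrix.add_apply, Matrix.smul_apply, Matrix.map_apply, add_zero,
          smul_eq_mul, map_add, map_mul, ← hroot]
        field_simp
        ring
    · rw [if_neg h2] at hroot
      refine ⟨-(Ext.gen K _)⁻¹, -Ext.gen K _, fun y => ?_, fun w => ?_⟩
      · choose p q hpq using fun i => h.exists_eq_add (y i)
        refine ⟨Sum.elim p (-q), funext fun i => ?_⟩
        simp only [combineVec, LinearMap.coe_mk, AddHom.coe_mk, Sum.elim_inl, Sum.elim_inr,
          Pi.neg_apply, map_neg, hpq]
        ring
      · funext i
        simp only [combineVec, LinearMap.coe_mk, AddHom.coe_mk, Matrix.mulVec, dotProduct,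
          Fintype.sum_sum_type, map_add, map_sum, Finset.mul_sum, mul_add,
          ← Finset.sum_add_distrib]
        refine Finset.sum_congr rfl fun j _ => ?_
        simp only [combineA, assemble, if_neg h2, liftMat, Matrix.fromBlocks_apply₁₁,
          Matrix.fromBlocks_apply₁₂, Matrix.fromBlocks_apply₂₁, Matrix.fromBlocks_apply₂₂,
          Matrix.sub_apply, Matrix.smul_apply, Matrix.map_apply, add_zero, sub_zero, smul_eq_mul,
          map_mul, ← hroot]
        field_simp
        ring
  have hle : (LinearMap.range (combineA K (α (Fin.last m)) A₀ A₁).mulVecLin).restrictScalars K ≤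
      (LinearMap.range (assemble K (a (Fin.last m)) A₀ A₁ 0 0).mulVecLin).map
        (combineVec m μ γ) := by
    rintro _ ⟨y, rfl⟩
    obtain ⟨w, rfl⟩ := hsurj y
    exact ⟨_, ⟨w, rfl⟩, (hmul w).symm⟩
  have : IsScalarTower K (Ext K (α (Fin.last m)))
      (LinearMap.range (combineA K (α (Fin.last m)) A₀ A₁).mulVecLin) :=
    ⟨fun s t y => Subtype.ext (smul_assoc s t y.1)⟩
  calc 2 * (combineA K (α (Fin.last m)) A₀ A₁).rank
      = Module.finrank K (Ext K (α (Fin.last m))) *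
        Module.finrank (Ext K (α (Fin.last m)))
          (LinearMap.range (combineA K (α (Fin.last m)) A₀ A₁).mulVecLin) := by
        rw [h.finrank_ext]; rfl
    _ = Module.finrank K
          (LinearMap.range (combineA K (α (Fin.last m)) A₀ A₁).mulVecLin) :=
        Module.finrank_mul_finrank K _ _
    _ = Module.finrank K
          ((LinearMap.range (combineA K (α (Fin.last m)) A₀ A₁).mulVecLin).restrictScalars K) := rfl
    _ ≤ _ := Submodule.finrank_mono hle
    _ ≤ _ := Submodule.finrank_map_le _ _

end IsMultiquadratic

theorem rank_pos_of_ne_zero {m n : Type} [Fintype n] [DecidableEq n] [Finite m]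
    {X : Matrix m n K} (hX : X ≠ 0) : 0 < X.rank := by
  refine Nat.pos_of_ne_zero fun h => hX ?_
  rw [Matrix.rank, Submodule.finrank_eq_zero, LinearMap.range_eq_bot] at h
  exact Matrix.toLin'.injective (by rw [map_zero]; exact h)

/-- The minimum rank distance of the codes. -/
theorem IsMultiquadratic.two_pow_le_rank : ∀ {m : ℕ} (K : Type u) [Field K] [Algebra K L]
    {c : (L ≃ₐ[K] L) → (Fin m → ZMod 2)} {a : Fin m → K} {α : Fin m → L},
    IsMultiquadratic K c a α → ∀ (r : ℕ) (X : SqMat m K), X ∈ RMmat K c α r → X ≠ 0 →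
      2 ^ m ≤ 2 ^ r * X.rank
  | 0, K, _, _, c, a, α, h, r, X, hX, hne => by
    have := rank_pos_of_ne_zero hne
    exact Nat.mul_pos (by positivity) this
  | m + 1, K, _, _, c, a, α, h, r, X, hX, hne => by
    obtain ⟨A₀, A₁, B₀, B₁, rfl, hA, hB⟩ := h.exists_assemble hX
    -- If the `B` part vanishes, the order stays `r` and the missing factor `2` comes from the
    -- degree of `K(x)` over `K`. Otherwise the order drops to `r - 1`, which supplies that factor.
    by_cases hB0 : combineB K (α (Fin.last m)) B₀ B₁ = 0
    · have hz : combineB K (α (Fin.last m)) (0 : SqMat m K) 0 = 0 := by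
        refine Matrix.ext fun i j => ?_
        unfold combineB
        split_ifs <;> simp [liftMat]
      obtain ⟨rfl, rfl⟩ := h.combineB_inj (hB0.trans hz.symm)
      have hA0 : combineA K (α (Fin.last m)) A₀ A₁ ≠ 0 := fun hA0 => by
        have hz : combineA K (α (Fin.last m)) (0 : SqMat m K) 0 = 0 := by
          refine Matrix.ext fun i j => ?_
          unfold combineA
          split_ifs <;> simp [liftMat]
        obtain ⟨rfl, rfl⟩ := h.combineA_inj (hA0.trans hz.symm)
        refine hne ?_
        unfold assemble
        split_ifs <;> simp <;> rfl
      have h1 := two_pow_le_rank (Ext K (α (Fin.last m))) h.ext r _ hA hA0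
      have h2 := h.two_mul_rank_combineA_le A₀ A₁
      calc 2 ^ (m + 1) = 2 ^ m * 2 := pow_succ 2 m
        _ ≤ 2 ^ r * (combineA K (α (Fin.last m)) A₀ A₁).rank * 2 := Nat.mul_le_mul_right 2 h1
        _ = 2 ^ r * (2 * (combineA K (α (Fin.last m)) A₀ A₁).rank) := by ring
        _ ≤ _ := Nat.mul_le_mul_left _ h2
    · cases r with
      | zero => exact absurd (h.ext.eq_zero_of_neg (by norm_num) hB) hB0
      | succ r =>
        have h1 := two_pow_le_rank (Ext K (α (Fin.last m))) h.ext r _ (by simpa using hB) hB0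
        have h2 := rank_fold_le (α (Fin.last m)) (assemble K (a (Fin.last m)) A₀ A₁ B₀ B₁)
        rw [h.fold_assemble] at h2
        calc 2 ^ (m + 1) = 2 * 2 ^ m := by ring
          _ ≤ 2 * (2 ^ r * (combineB K (α (Fin.last m)) B₀ B₁).rank) :=
            Nat.mul_le_mul_left _ h1
          _ = 2 ^ (r + 1) * (combineB K (α (Fin.last m)) B₀ B₁).rank := by ring
          _ ≤ _ := Nat.mul_le_mul_left _ h2

end Fold

theorem card_idx : ∀ m : ℕ, Fintype.card (Idx m) = 2 ^ m
  | 0 => rfl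
  | m + 1 => by
    have h : Fintype.card (Idx (m + 1)) = Fintype.card (Idx m) + Fintype.card (Idx m) :=
      Fintype.card_sum
    rw [h, card_idx m, pow_succ, mul_two]

/-! ### Erasure decoding and the recursive decoder -/

section Decoding

variable {K : Type u} {L : Type u} [Field K] [Field L] [Algebra K L]

theorem exists_isParityCheck {m : ℕ} (W : Submodule L (Idx m → L)) :
    ∃ H : Matrix (Fin (2 ^ m - Module.finrank L W)) (Idx m) L, IsParityCheck W H := by
  have hdim : Module.finrank L ((Idx m → L) ⧸ W) =
      Module.finrank L (Fin (2 ^ m - Module.finrank L W) → L) := by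
    rw [Submodule.finrank_quotient, Module.finrank_fin_fun, Module.finrank_fintype_fun_eq_card,
      card_idx]
  let f := (LinearEquiv.ofFinrankEq _ _ hdim).toLinearMap ∘ₗ W.mkQ
  refine ⟨LinearMap.toMatrix' f, fun v => ?_⟩
  rw [LinearMap.toMatrix'_mulVec]
  simp [f]

theorem toVec_eq_vecMul {m : ℕ} (α : Fin m → L) (X : SqMat m K) :
    toVec K α X = basisFam m α ᵥ* X.map (algebraMap K L) := by
  funext j
  simp [toVec_apply, Matrix.vecMul, dotProduct, mul_comm]

theorem toVec_add {m : ℕ} (α : Fin m → L) (X Y : SqMat m K) :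
    toVec K α (X + Y) = toVec K α X + toVec K α Y := by
  rw [toVec_eq_vecMul, toVec_eq_vecMul, toVec_eq_vecMul, ← Matrix.vecMul_add]
  congr 1
  ext
  simp

theorem toVec_mul {m : ℕ} {n : Type} [Fintype n] (α : Fin m → L) (Z : Matrix (Idx m) n K)
    (R : Matrix n (Idx m) K) :
    toVec K α (Z * R) =
      (basisFam m α ᵥ* Z.map (algebraMap K L)) ᵥ* R.map (algebraMap K L) := by
  rw [toVec_eq_vecMul, Matrix.map_mul, Matrix.vecMul_vecMul]

namespace IsMultiquadratic

variable {m : ℕ} {c : (L ≃ₐ[K] L) → (Fin m → ZMod 2)} {a : Fin m → K} {α : Fin m → L}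

/-- Expanding `z` in the basis shows that `z R` represents a matrix `Z R` over `K`. Its rank is at
most `d`, below the minimum distance. -/
theorem vecMul_eq_zero_of_mem (h : IsMultiquadratic K c a α) {r d : ℕ} (hd : 2 ^ r * d < 2 ^ m)
    (R : Matrix (Fin d) (Idx m) K) (z : Fin d → L)
    (hz : z ᵥ* R.map (algebraMap K L) ∈ RMvec K c α r) : z ᵥ* R.map (algebraMap K L) = 0 := by
  choose w hw using fun k => h.basisFam_surjective K (z k)
  obtain ⟨Z, rfl⟩ : ∃ Z : Matrix (Idx m) (Fin d) K,
      z = basisFam m α ᵥ* Z.map (algebraMap K L) := by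
    refine ⟨Matrix.of fun i k => w k i, funext fun k => ?_⟩
    rw [hw k]
    simp [Matrix.vecMul, dotProduct, mul_comm]
  rw [← toVec_mul] at hz ⊢
  have h0 : Z * R = 0 := by
    by_contra hne
    have hmem : Z * R ∈ RMmat K c α r := mem_RMmat_iff_toVec.2 hz
    have h1 := h.two_pow_le_rank K r _ hmem hne
    have h2 : (Z * R).rank ≤ d := by
      refine (Matrix.rank_mul_le_right Z R).trans ((Matrix.rank_le_card_height R).trans_eq ?_)
      exact Fintype.card_fin d
    exact absurd (h1.trans (Nat.mul_le_mul_left _ h2)) (not_le.2 hd)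
  rw [h0, toVec_eq_vecMul]
  simp

/-- Correctness of the erasure decoder. -/
theorem erasureDecRM_iff (h : IsMultiquadratic K c a α) {r : ℕ} {C E : SqMat m K}
    (hC : C ∈ RMmat K c α r) {V : Submodule K (Idx m → K)} (hE : ∀ i, E i ∈ V)
    (hV : 2 ^ r * Module.finrank K V < 2 ^ m) (out : Option (SqMat m K)) :
    ErasureDecRM K c α r (C + E) V out ↔ out = some C := by
  have hCvec := mem_RMmat_iff_toVec.1 hC
  have hsol : ∀ (H : Matrix (Fin (2 ^ m - Module.finrank L (RMvec K c α r))) (Idx m) L),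
      IsParityCheck (RMvec K c α r) H →
      ∀ (R : Matrix (Fin (Module.finrank K V)) (Idx m) K) (z : Fin (Module.finrank K V) → L),
      (H * (R.map (algebraMap K L))ᵀ) *ᵥ z = H *ᵥ toVec K α (C + E) ↔
        z ᵥ* R.map (algebraMap K L) - toVec K α E ∈ RMvec K c α r := by
    intro H hH R z
    rw [← Matrix.mulVec_mulVec, Matrix.mulVec_transpose, ← sub_eq_zero, ← Matrix.mulVec_sub,
      ← hH, toVec_add, ← sub_sub, sub_right_comm]
    exact Submodule.sub_mem_iff_left _ hCvec
  have hex : ∀ R : Matrix (Fin (Module.finrank K V)) (Idx m) K, rowSpace K R = V →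
      ∃ z : Fin (Module.finrank K V) → L, toVec K α E = z ᵥ* R.map (algebraMap K L) := by
    intro R hR
    obtain ⟨Z, hZ⟩ := exists_eq_mul_of_rows_mem (R := R) (X := E) fun i => hR.symm ▸ hE i
    exact ⟨_, (congrArg (toVec K α) hZ).trans (toVec_mul α Z R)⟩
  constructor
  · rintro ⟨H, hH, R, hR, hrun⟩
    obtain ⟨z₀, hz₀⟩ := hex R hR
    rcases hrun with ⟨z, hz, E', hE', rfl⟩ | ⟨hno, -⟩
    -- Any solution `z` differs from the true one `z₀` by a vector with `(z - z₀) R` in the code,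
    -- hence zero: `z` itself need not be unique, but `z R` is.
    · rw [hsol H hH, hz₀, ← Matrix.sub_vecMul] at hz
      have h1 := h.vecMul_eq_zero_of_mem hV R _ hz
      rw [Matrix.sub_vecMul, ← hz₀, ← hE', sub_eq_zero] at h1
      rw [h.toVec_injective h1, add_sub_cancel_right]
    · exact absurd ⟨z₀, (hsol H hH R z₀).2 (by rw [hz₀, sub_self]; exact zero_mem _)⟩ hno
  · rintro rfl
    obtain ⟨H, hH⟩ := exists_isParityCheck (RMvec K c α r)
    obtain ⟨R, hR⟩ := exists_rowSpace_eq V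
    obtain ⟨z₀, hz₀⟩ := hex R hR
    refine ⟨H, hH, R, hR, Or.inl ⟨z₀, (hsol H hH R z₀).2 ?_, E, hz₀, ?_⟩⟩
    · rw [hz₀, sub_self]
      exact zero_mem _
    · rw [add_sub_cancel_right]

end IsMultiquadratic

/-- The folding is a left multiple of the right-hand product, which gives one inclusion. The product
has rank at most that of `E`, so the rank assumption forces equality of dimensions. -/
theorem rowSpace_fold_eq {m : ℕ} {x : L} {E : BlockMat m K}
    (h : (fold K x E).rank = E.rank) :
    rowSpace (Ext K x) (fold K x E) = rowSpace (Ext K x) (liftMat K x E * rightFactor K m x) := by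
  refine Submodule.eq_of_le_of_finrank_le ?_ ?_
  · rw [fold, Matrix.mul_assoc]
    exact rowSpace_mul_le _ _
  · rw [finrank_rowSpace, finrank_rowSpace, h]
    exact rank_liftMat_mul_rightFactor_le x E

theorem lowerHalf_mem_rowSpace_fold {m : ℕ} {x : L} {E : BlockMat m K}
    (h : (fold K x E).rank = E.rank) (i : Idx m) :
    lowerHalf (liftMat K x E * rightFactor K m x) i ∈ rowSpace (Ext K x) (fold K x E) := by
  rw [rowSpace_fold_eq h]
  exact row_mem_rowSpace _ (Sum.inr i)

/-- Correctness of the recursive decoder, for a code of order `s - 1`. -/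
theorem IsMultiquadratic.decodeRM_iff : ∀ {m : ℕ} (K : Type u) [Field K] [Algebra K L]
    {c : (L ≃ₐ[K] L) → (Fin m → ZMod 2)} {a : Fin m → K} {α : Fin m → L},
    IsMultiquadratic K c a α → ∀ {s t : ℕ} {r : ℤ}, r + 1 = s → 2 ^ s * (t + 1) ≤ 2 ^ m →
      ∀ {C E : SqMat m K}, C ∈ RMmat K c α r → E.rank = t →
      (∀ i ≤ m, i ≤ s → foldRank m K α E i = t) → ∀ out : Option (SqMat m K),
      DecodeRM m K c a α r (C + E) out ↔ out = some C
  | 0, K, _, _, c, a, α, h, s, t, r, hr, ht, C, E, hC, hE, hfold, out => by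
    -- A `1 × 1` matrix leaves no room for `s > 0`, so the failure case of the algorithm at `m = 0`
    -- is never reached.
    have hs : s = 0 := by
      by_contra h0
      have h1 : 2 ≤ 2 ^ s := Nat.le_self_pow h0 2
      nlinarith
    obtain rfl : r = -1 := by omega
    rw [h.eq_zero_of_neg (by norm_num) hC]
    simp [DecodeRM]
  | m + 1, K, _, _, c, a, α, h, 0, t, r, hr, ht, C, E, hC, hE, hfold, out => by
    obtain rfl : r = -1 := by omega
    rw [h.eq_zero_of_neg (by norm_num) hC]
    simp [DecodeRM]
  | m + 1, K, _, _, c, a, α, h, k + 1, t, r, hr, ht, C, E, hC, hE, hfold, out => by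
    obtain rfl : r = k := by push_cast at hr; omega
    obtain ⟨A₀, A₁, B₀, B₁, rfl, hA, hB⟩ := h.exists_assemble hC
    have hk : 2 ^ k * (t + 1) ≤ 2 ^ m := by
      rw [pow_succ, pow_succ] at ht
      nlinarith
    have hfoldE : (fold K (α (Fin.last m)) E).rank = t := by
      have := hfold 1 (by omega) (by omega)
      cases m <;> exact this
    have hrank : (fold K (α (Fin.last m)) E).rank = Matrix.rank (show BlockMat m K from E) :=
      hfoldE.trans hE.symm
    have hfoldY : fold K (α (Fin.last m))
        (assemble K (a (Fin.last m)) A₀ A₁ B₀ B₁ + (show BlockMat m K from E)) =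
        combineB K (α (Fin.last m)) B₀ B₁ + fold K (α (Fin.last m)) E := by
      rw [fold_add, h.fold_assemble]
    have hrec := decodeRM_iff (Ext K (α (Fin.last m))) h.ext (s := k) (t := t)
      (r := (k : ℤ) - 1) (by ring) hk hB hfoldE
      (fun i him hik => hfold (i + 1) (by omega) (by omega))
    -- The strict bound `2 ^ k * t < 2 ^ m` demanded by erasure decoding comes from the `t + 1` in
    -- `hk`.
    have her := h.ext.erasureDecRM_iff hA (lowerHalf_mem_rowSpace_fold hrank)
      (by rw [finrank_rowSpace, hfoldE]
          exact lt_of_lt_of_le (Nat.mul_lt_mul_of_pos_left (Nat.lt_succ_self t) (by positivity)) hk)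
    have hY₀ : lowerHalf (liftMat K (α (Fin.last m))
        (assemble K (a (Fin.last m)) A₀ A₁ B₀ B₁ + (show BlockMat m K from E) -
          assemble K (a (Fin.last m)) 0 0 B₀ B₁) * rightFactor K m (α (Fin.last m))) =
        combineA K (α (Fin.last m)) A₀ A₁ +
          lowerHalf (liftMat K (α (Fin.last m)) (show BlockMat m K from E) *
            rightFactor K m (α (Fin.last m))) := by
      rw [assemble_add (a (Fin.last m)) A₀ A₁ B₀ B₁, add_right_comm, add_sub_cancel_right,
        liftMat_add, Matrix.add_mul, ← lowerHalf_assemble _ (a (Fin.last m))]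
      rfl
    have hr' : (k : ℤ) ≠ -1 := by omega
    have hYM : combineB K (α (Fin.last m)) B₀ B₁ + fold K (α (Fin.last m)) E -
        combineB K (α (Fin.last m)) B₀ B₁ = fold K (α (Fin.last m)) E := add_sub_cancel_left _ _
    have hY : ∀ o, DecodeRM m (Ext K (α (Fin.last m))) (initCoord K (α (Fin.last m)) c)
        (fun i => algebraMap K (Ext K (α (Fin.last m))) (a i.castSucc)) (Fin.init α) (k - 1)
        (fold K (α (Fin.last m))
          (assemble K (a (Fin.last m)) A₀ A₁ B₀ B₁ + (show BlockMat m K from E))) o ↔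
        o = some (combineB K (α (Fin.last m)) B₀ B₁) := fun o => by
      rw [hfoldY]
      exact hrec o
    have hW : ∀ o, ErasureDecRM (Ext K (α (Fin.last m))) (initCoord K (α (Fin.last m)) c)
        (Fin.init α) k
        (lowerHalf (liftMat K (α (Fin.last m))
          (assemble K (a (Fin.last m)) A₀ A₁ B₀ B₁ + (show BlockMat m K from E) -
            assemble K (a (Fin.last m)) 0 0 B₀ B₁) * rightFactor K m (α (Fin.last m))))
        (rowSpace _ (fold K (α (Fin.last m))
          (assemble K (a (Fin.last m)) A₀ A₁ B₀ B₁ + (show BlockMat m K from E)) -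
          combineB K (α (Fin.last m)) B₀ B₁)) o ↔
        o = some (combineA K (α (Fin.last m)) A₀ A₁) := fun o => by
      rw [hY₀, hfoldY, hYM]
      exact her o
    constructor
    -- Both subroutines have a single possible outcome, and the decompositions into `B₀, B₁` and
    -- `A₀, A₁` are unique because `1, x` are independent over `K`.
    · rintro (⟨h0, -⟩ | ⟨-, ⟨hrun, -⟩ | ⟨M, hM, B₀', B₁', hB', hrun⟩⟩)
      · exact absurd h0 hr'
      · exact absurd ((hY none).1 hrun) (by simp)
      · have hM' := Option.some.inj ((hY (some M)).1 hM)
        obtain ⟨rfl, rfl⟩ := h.combineB_inj (hM'.symm.trans hB')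
        subst hM'
        rcases hrun with ⟨hrun, -⟩ | ⟨W, hrun, A₀', A₁', hA', rfl⟩
        · exact absurd ((hW none).1 hrun) (by simp)
        · have hW' := Option.some.inj ((hW (some W)).1 hrun)
          obtain ⟨rfl, rfl⟩ := h.combineA_inj (hW'.symm.trans hA')
          rfl
    · rintro rfl
      exact Or.inr ⟨hr', Or.inr ⟨_, (hY _).2 rfl, B₀, B₁, rfl, Or.inr
        ⟨_, (hW _).2 rfl, A₀, A₁, rfl, rfl⟩⟩⟩

end Decoding

/-! ### From the Galois group to coordinates -/

section Galois

variable {K : Type u} {L : Type u} [Field K] [Field L] [Algebra K L]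

/-- An automorphism acts on the generators as prescribed by its coordinates. -/
theorem IsGeneratingSystem.act {m : ℕ} {e : (L ≃ₐ[K] L) ≃* Multiplicative (Fin m → ZMod 2)}
    {a : Fin m → K} {α : Fin m → L} (h : IsGeneratingSystem K e a α) (g : L ≃ₐ[K] L)
    (j : Fin m) :
    g (α j) = if Multiplicative.toAdd (e g) j = 0 then α j else conjRoot K (α j) := by
  have hgen : ∀ i j, e.symm (Multiplicative.ofAdd (Pi.single i 1)) (α j) =
      if i = j then conjRoot K (α j) else α j := fun i j => by
    by_cases h2 : ringChar K = 2
    · rw [(h.artinSchreier h2 j).2 i, conjRoot, if_pos h2]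
      split_ifs <;> simp
    · rw [(h.kummer h2 j).2 i, conjRoot, if_neg h2]
      split_ifs <;> simp
  have hsingle : ∀ (i : Fin m) (b : ZMod 2) j,
      e.symm (Multiplicative.ofAdd (Pi.single i b)) (α j) =
        if (Pi.single i b : Fin m → ZMod 2) j = 0 then α j else conjRoot K (α j) := by
    intro i b j
    have hb : b = 0 ∨ b = 1 := by revert b; decide
    rcases hb with rfl | rfl
    · simp
    · rw [hgen]
      by_cases hij : i = j
      · subst hij; simp
      · simp [hij, Ne.symm hij]
  -- The coordinate vector is built up one generator at a time; two conjugations of the same root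
  -- cancel, matching addition in `ZMod 2`.
  have key : ∀ s : Finset (Fin m), ∀ v : Fin m → ZMod 2, ∀ j,
      e.symm (Multiplicative.ofAdd (∑ i ∈ s, Pi.single i (v i))) (α j) =
        if (∑ i ∈ s, Pi.single i (v i) : Fin m → ZMod 2) j = 0 then α j
          else conjRoot K (α j) := by
    intro s v
    induction s using Finset.induction_on with
    | empty => intro j; simp
    | insert i s hi ih =>
      intro j
      rw [Finset.sum_insert hi, ofAdd_add, map_mul, AlgEquiv.mul_apply, ih]
      have hcases : ∀ b b' : ZMod 2, b + b' = 0 ↔ (b = 0 ↔ b' = 0) := by decide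
      simp only [Pi.add_apply, hcases]
      split_ifs <;> simp_all [map_conjRoot, conjRoot_conjRoot]
  have := key Finset.univ (Multiplicative.toAdd (e g)) j
  rw [Finset.univ_sum_single] at this
  simpa using this

theorem IsGeneratingSystem.isMultiquadratic {m : ℕ}
    {e : (L ≃ₐ[K] L) ≃* Multiplicative (Fin m → ZMod 2)} {a : Fin m → K} {α : Fin m → L}
    (h : IsGeneratingSystem K e a α) :
    IsMultiquadratic K (fun g => Multiplicative.toAdd (e g)) a α where
  adjoin_eq_top := h.adjoin_eq_top
  root j := by
    split_ifs with h2
    · exact (h.artinSchreier h2 j).1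
    · exact (h.kummer h2 j).1
  act := h.act
  surj v := ⟨e.symm (Multiplicative.ofAdd v), by simp⟩
  conj_ne j hj := by
    -- If `α j` were its own conjugate, the generator `θ_j` would fix every `α i` and so be the
    -- identity.
    have h1 : e.symm (Multiplicative.ofAdd (Pi.single j 1)) = 1 := by
      refine algEquiv_ext_of_adjoin h.adjoin_eq_top fun i => ?_
      rw [h.act, AlgEquiv.one_apply]
      split_ifs with h0
      · rfl
      · by_cases hij : i = j
        · rw [hij, hj]
        · simp [hij] at h0
    rw [map_eq_one_iff e.symm e.symm.injective] at h1
    have h2 := congrFun (congrArg Multiplicative.toAdd h1) j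
    simp at h2

end Galois

end RankRM

end

theorem mainTheorem4 {K L : Type u} [Field K] [Field L] [Algebra K L]
    [FiniteDimensional K L] [IsGalois K L] (m : ℕ)
    (e : (L ≃ₐ[K] L) ≃* Multiplicative (Fin m → ZMod 2))
    (a : Fin m → K) (α : Fin m → L) (hα : RankRM.IsGeneratingSystem K e a α)
    (r : ℤ) (hr : -1 ≤ r) (hrm : r ≤ m)
    (C E : RankRM.SqMat m K)
    (hC : C ∈ RankRM.RMmat K (fun g => Multiplicative.toAdd (e g)) α r)
    (t : ℕ) (hE : E.rank = t) (ht : (t : ℚ) ≤ (2 : ℚ) ^ ((m : ℤ) - r - 1) - 1)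
    (hfold : ∀ i : ℕ, i ≤ m → (i : ℤ) ≤ r + 1 → RankRM.foldRank m K α E i = t) :
    ∀ out : Option (RankRM.SqMat m K),
      RankRM.DecodeRM m K (fun g => Multiplicative.toAdd (e g)) a α r (C + E) out ↔
        out = some C := by
  obtain ⟨s, hs⟩ := Int.eq_ofNat_of_zero_le (by omega : 0 ≤ r + 1)
  refine hα.isMultiquadratic.decodeRM_iff K hs ?_ hC hE fun i him his => hfold i him (by omega)
  have hexp : (m : ℤ) - r - 1 = m - s := by omega
  -- The exponent is `-1` when `r = m`, which makes the bound on `t` unsatisfiable; clearing the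
  -- denominator `2 ^ s` treats all cases alike.
  rw [hexp, zpow_sub₀ two_ne_zero, zpow_natCast, zpow_natCast] at ht
  have h1 : (t : ℚ) + 1 ≤ 2 ^ m / 2 ^ s := by linarith
  rw [le_div_iff₀ (by positivity)] at h1
  have h2 : (2 : ℚ) ^ s * (t + 1) ≤ 2 ^ m := by linarith
  exact_mod_cast h2
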